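/- Let $K$ be a field, $n\ge t\ge 1$ integers, $S=K[x_1,\dots,x_n]$ with the standard grading, and $\mathfrak m=(x_1,\dots,x_n)$. A monomial $x_{i_1}\cdots x_{i_d}$ with $i_1\le\dots\le i_d$ is $t$-spread if $i_{j+1}-i_j\ge t$ for all $1\le j<d$; a $t$-spread ideal is an ideal generated by $t$-spread monomials. Let $M_{n,d,t}$ be the set of $t$-spread monomials of degree $d$ in $S$ and, for a monomial ideal $J$, let $[J]_{d,t}=M_{n,d,t}\cap J$. The $f_t$-vector of $J$ has the entries $$f_{t,d-1}(J)=|M_{n,d,t}|-|[J]_{d,t}|,\qquad d\ge 0 .$$ A $t$-spread ideal $L$ is a $t$-spread lexsegment ideal if for all $d$, all $u\in[L]_{d,t}$ and all $v\in M_{n,d,t}$ with $v\ge_{\mathrm{slex}}u$ (squarefree lexicographic order, $x_1>\dots>x_n$) one has $v\in[L]_{d,t}$. A nonzero graded Betti number $\beta_{i,j}(J)$ (for a graded ideal $J$, $i$ the homological and $j$ the internal degree) is extremal if $\beta_{p,q}(J)=0$ for all $p,q$ with $p\ge i$, $q-p\ge j-i$ and $q\ge j+1$. Let $I\subset S$ be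 the Pascal ideal of type $(n,t)$, that is, the ideal generated by the $t$ monomials $$\mathbf x_{n,t,r}=\prod_{\substack{1\le j\le n\\ j\equiv r\ (\mathrm{mod}\ t)}}x_j,\qquad r=1,\dots,t .$$ Then: (a) $S/I$ is a Cohen–Macaulay ring. (b) $I$ has exactly one extremal Betti number, that is, there is exactly one pair $(i,j)$ such that $\beta_{i,j}(I)$ is extremal. Moreover $\operatorname{pd}(I)=t-1$, and $\operatorname{reg}(I)=\operatorname{depth}(I)=n-(t-1)$, where $\operatorname{pd}$, $\operatorname{reg}$ and $\operatorname{depth}$ (with respect to $\mathfrak m$) are those of the graded $S$-module $I$. Let moreover $i\in\{1,\dots,t\}$ be such that $n\equiv i\pmod t$, and put $k=\lfloor (n-1)/t\rfloor$. Then: (c) for every $d\ge 0$, $$f_{t,d-1}(I)=\begin{cases}\binom{n-(d-1)(t-1)}{d}&\text{if } d\le k-1,\\[2pt] \binom{n-(d-1)(t-1)}{d}-(t-i)&\text{if } d=k,\\[2pt] \binom{n-(d-1)(t-1)}{d}-i&\text{if } d=k+1,\\[2pt] 0&\text{if } d>k+1.\end{cases}$$ (d) The Hilbert series $\mathrm{Hilb}_{S/I}(z)=\sum_{d\ge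 0}\dim_K (S/I)_d\,z^d$ is $$\mathrm{Hilb}_{S/I}(z)=\frac{(1+z+\dots+z^{k})^{i}\,(1+z+\dots+z^{k-1})^{t-i}}{(1-z)^{n-t}},$$ where for $k=0$ (that is, $n=t$, and then $i=t$) the second factor is read as $1$. (e) There exists a $t$-spread lexsegment ideal $L$ of $S$ with $f_t(L)=f_t(I)$ if and only if $i\in\{1,t-1,t\}$. -/

import Mathlib

open scoped PowerSeries

namespace PascalIdeal

/-! ## Depth and Cohen–Macaulay rings -/

section Depth

universe u v

/-- The supremum of the lengths of the `M`-regular sequences consisting of elements of `J`.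
For a local ring with maximal ideal `J`, or a standard graded polynomial ring with `J` generated by
the variables, this is the depth of `M`. -/
noncomputable def moduleDepth {R : Type u} [CommRing R] (J : Ideal R)
    (M : Type v) [AddCommGroup M] [Module R M] : ℕ∞ :=
  sSup {l : ℕ∞ | ∃ rs : List R,
    (∀ r ∈ rs, r ∈ J) ∧ RingTheory.Sequence.IsRegular M rs ∧ l = (rs.length : ℕ∞)}

/-- A Noetherian ring `R` is Cohen–Macaulay if `depth R_𝔭 = dim R_𝔭` for each maximal ideal `𝔭`. -/
structure IsCohenMacaulayRing (R : Type u) [CommRing R] : Prop where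
  isNoetherianRing : IsNoetherianRing R
  depth_eq_dim : ∀ (p : Ideal R) [p.IsMaximal],
    ((moduleDepth (IsLocalRing.maximalIdeal (Localization.AtPrime p))
      (Localization.AtPrime p) : ℕ∞) : WithBot ℕ∞) = ringKrullDim (Localization.AtPrime p)

end Depth

section Polynomial

universe u

variable {n : ℕ} {K : Type u} [Field K]

/-- The graded maximal ideal `(x_1, …, x_n)` of `K[x_1, …, x_n]`. -/
noncomputable def gradedMaximalIdeal (n : ℕ) (K : Type u) [Field K] :
    Ideal (MvPolynomial (Fin n) K) :=
  Ideal.span (Set.range MvPolynomial.X)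

/-! ## Minimal graded free resolutions, Betti numbers, projective dimension, regularity -/

/-- A minimal graded free resolution `⋯ → F_1 → F_0 → I → 0` of an ideal `I` of
`S = K[x_1, …, x_n]`, where `F_i` is the free module on `rank i` generators and the `a`-th generator
has degree `deg i a`, i.e. `F_i = ⨁_a S(-deg i a)`. -/
structure MinimalGradedFreeResolution (I : Ideal (MvPolynomial (Fin n) K)) where
  /-- rank of `F_i` -/
  rank : ℕ → ℕ
  /-- degrees of the generators of `F_i` -/
  deg : (i : ℕ) → Fin (rank i) → ℕ
  /-- the augmentation `F_0 → I ⊆ S` -/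
  aug : (Fin (rank 0) → MvPolynomial (Fin n) K) →ₗ[MvPolynomial (Fin n) K]
    MvPolynomial (Fin n) K
  /-- the differential `F_{i+1} → F_i` -/
  d : (i : ℕ) → (Fin (rank (i + 1)) → MvPolynomial (Fin n) K) →ₗ[MvPolynomial (Fin n) K]
    (Fin (rank i) → MvPolynomial (Fin n) K)
  /-- the augmentation preserves degrees -/
  aug_homogeneous : ∀ b, (aug (Pi.single b 1)).IsHomogeneous (deg 0 b)
  /-- the differentials preserve degrees: each nonzero matrix entry is homogeneous of degree the
  difference of the degrees of the two generators -/
  d_homogeneous : ∀ i b a, d i (Pi.single b 1) a ≠ 0 →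
    ∃ m : ℕ, m + deg i a = deg (i + 1) b ∧ (d i (Pi.single b 1) a).IsHomogeneous m
  range_aug : LinearMap.range aug = I
  exact_zero : Function.Exact (d 0) aug
  exact_succ : ∀ i, Function.Exact (d (i + 1)) (d i)
  /-- minimality: the image of `F_{i+1}` lies in `(x_1, …, x_n) F_i` -/
  minimal : ∀ i x a, d i x a ∈ gradedMaximalIdeal n K

/-- The number of copies of `S(-j)` in `F_i`. -/
def MinimalGradedFreeResolution.betti {I : Ideal (MvPolynomial (Fin n) K)}
    (F : MinimalGradedFreeResolution I) (i j : ℕ) : ℕ :=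
  (Finset.univ.filter fun a : Fin (F.rank i) => F.deg i a = j).card

open Classical in
/-- The graded Betti number `β_{i,j}(I)`, read off a minimal graded free resolution of `I`. Every
graded ideal has one, and it is unique up to isomorphism; an ideal that is not graded has none and
gets the value `0`. -/
noncomputable def gradedBetti (I : Ideal (MvPolynomial (Fin n) K)) (i j : ℕ) : ℕ :=
  if h : Nonempty (MinimalGradedFreeResolution I) then h.some.betti i j else 0

/-- `β_{i,j}(I) ≠ 0` is extremal: `β_{p,q}(I) = 0` whenever `p ≥ i`, `q - p ≥ j - i` and
`q ≥ j + 1`. -/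
def IsExtremalBetti (I : Ideal (MvPolynomial (Fin n) K)) (i j : ℕ) : Prop :=
  gradedBetti I i j ≠ 0 ∧
    ∀ p q : ℕ, i ≤ p → (j : ℤ) - (i : ℤ) ≤ (q : ℤ) - (p : ℤ) → j + 1 ≤ q → gradedBetti I p q = 0

/-- `pd(I) = max {i : β_i(I) ≠ 0}`. -/
def HasProjDim (I : Ideal (MvPolynomial (Fin n) K)) (p : ℕ) : Prop :=
  IsGreatest {i : ℕ | ∃ j, gradedBetti I i j ≠ 0} p

/-- `reg(I) = max {j - i : β_{i,j}(I) ≠ 0}`. -/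
def HasRegularity (I : Ideal (MvPolynomial (Fin n) K)) (r : ℤ) : Prop :=
  IsGreatest {s : ℤ | ∃ i j : ℕ, gradedBetti I i j ≠ 0 ∧ s = (j : ℤ) - (i : ℤ)} r

/-! ## Hilbert series -/

/-- The component of degree `d` of `S/I`. -/
noncomputable def quotientPiece (I : Ideal (MvPolynomial (Fin n) K)) (d : ℕ) :
    Submodule K (MvPolynomial (Fin n) K ⧸ I) :=
  (MvPolynomial.homogeneousSubmodule (Fin n) K d).map (Ideal.Quotient.mkₐ K I).toLinearMap

/-- The Hilbert series `∑_d dim_K (S/I)_d z^d`. -/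
noncomputable def hilbertSeries (I : Ideal (MvPolynomial (Fin n) K)) : ℚ⟦X⟧ :=
  PowerSeries.mk fun d => (Module.finrank K (quotientPiece I d) : ℚ)

/-! ## `t`-spread monomials and ideals, for `t ≥ 1`

The variable `x_j`, `1 ≤ j ≤ n`, is `MvPolynomial.X` at the index `j - 1` of `Fin n`. For `t ≥ 1` a
`t`-spread monomial is squarefree, hence of the form `x_F = ∏_{j ∈ F} x_j`; it is represented by its
support `F`. -/

/-- The squarefree monomial `x_F`. -/
noncomputable def squarefreeMonomial (K : Type u) [Field K] (F : Finset (Fin n)) :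
    MvPolynomial (Fin n) K :=
  ∏ a ∈ F, MvPolynomial.X a

/-- `x_F` is `t`-spread (`t ≥ 1`). Requiring `b - a ≥ t` for consecutive elements `a < b` of `F` is
the same as requiring it for all pairs `a < b` in `F`. -/
def IsTSpread (t : ℕ) (F : Finset (Fin n)) : Prop :=
  ∀ a ∈ F, ∀ b ∈ F, a < b → (a : ℕ) + t ≤ (b : ℕ)

/-- The (supports of the) monomials in `M_{n,d,t}`: `t`-spread of degree `d`. -/
def tSpreadSet (n d t : ℕ) : Set (Finset (Fin n)) :=
  {F | F.card = d ∧ IsTSpread t F}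

/-- The (supports of the) monomials in `[I_d]_t`: `t`-spread of degree `d` and lying in `I`. -/
def tSpreadPart (I : Ideal (MvPolynomial (Fin n) K)) (d t : ℕ) : Set (Finset (Fin n)) :=
  {F | F ∈ tSpreadSet n d t ∧ squarefreeMonomial K F ∈ I}

/-- The entry `|M_{n,d,t}| - |[I_d]_t|` in degree `d ≥ 0` of the `f_t`-vector of `I`; it is commonly
written `f_{t,d-1}(I)`. -/
noncomputable def fVector (t : ℕ) (I : Ideal (MvPolynomial (Fin n) K)) (d : ℕ) : ℤ :=
  ((tSpreadSet n d t).ncard : ℤ) - ((tSpreadPart I d t).ncard : ℤ)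

/-- `I` is generated by `t`-spread monomials. -/
def IsTSpreadIdeal (t : ℕ) (I : Ideal (MvPolynomial (Fin n) K)) : Prop :=
  ∃ G : Set (Finset (Fin n)), (∀ F ∈ G, IsTSpread t F) ∧
    I = Ideal.span (squarefreeMonomial K '' G)

/-- The squarefree lexicographic order `x_F ≥_slex x_G` on monomials of the same degree, with
`x_1 > x_2 > ⋯ > x_n`: either `F = G`, or at the first place where `F` and `G`, listed increasingly,
differ, the entry of `F` is smaller. For `|F| = |G|` this says that the least element of the
symmetric difference lies in `F`. -/
def SlexGE (F G : Finset (Fin n)) : Prop :=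
  F = G ∨ ∃ a, a ∈ F ∧ a ∉ G ∧ ∀ b < a, (b ∈ F ↔ b ∈ G)

/-- A `t`-spread ideal `I` is a `t`-spread lexsegment ideal if each `[I_d]_t` contains, with a
monomial `u`, all the monomials `v ≥_slex u` of `M_{n,d,t}`. -/
def IsTSpreadLexIdeal (t : ℕ) (I : Ideal (MvPolynomial (Fin n) K)) : Prop :=
  IsTSpreadIdeal t I ∧ ∀ d : ℕ, ∀ u ∈ tSpreadPart I d t, ∀ v ∈ tSpreadSet n d t,
    SlexGE v u → v ∈ tSpreadPart I d t

/-! ## The Pascal ideal -/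

/-- The set of all `j`, `1 ≤ j ≤ n`, with `j ≡ i (mod t)`, as indices `j - 1` in `Fin n`. -/
def residueClass (n t i : ℕ) : Finset (Fin n) :=
  Finset.univ.filter fun j : Fin n => (j : ℕ) + 1 ≡ i [MOD t]

/-- The Pascal ideal of type `(n, t)`, generated by the monomials
`x_{n,t,i} = ∏_{j ≡ i (mod t), 1 ≤ j ≤ n} x_j`, `1 ≤ i ≤ t`. -/
noncomputable def pascalIdeal (n t : ℕ) (K : Type u) [Field K] :
    Ideal (MvPolynomial (Fin n) K) :=
  Ideal.span {f | ∃ i : ℕ, 1 ≤ i ∧ i ≤ t ∧ f = squarefreeMonomial K (residueClass n t i)}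

end Polynomial

end PascalIdeal

/-! The map `ρ : j ↦ j mod t` on indices is idempotent with `t` fixed points, and `I` is generated
by the products `f_r` of the variables over its fibres. The `f_r` live in disjoint sets of
variables, so `I` is a complete intersection with `i` generators of degree `k + 1` and `t - i` of
degree `k`. Parts (a), (b) and (d) are developed for any idempotent `ρ`.

The regularity statement behind them is `mem_span_of_systemOf_mul_mem`: in the system of the `f_r`
together with arbitrary monic polynomials `g_j` in `X j - X (ρ j)`, one for each non-fixed `j`,
every member is a nonzerodivisor modulo any set of others. The freedom in `g_j` serves (a): at a
maximal ideal `p` the differences need not vanish, but they are algebraic over `K` in the residue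
field, and their minimal polynomials give `n - t` regular elements inside `p`. The `f_r` themselves
bound the dimension of `S/I` by `n - t`.

For `depth I`, the differences followed by one variable are a regular sequence of length `n - t + 1`
on `I`, and an explicit socle element modulo it shows, through `Ext`, that no longer one exists.
Iterated mapping cones yield the Koszul resolution, whose only generator of degree `n` is in the
last position; comparison of minimal resolutions makes the arbitrary choice in `gradedBetti`
harmless. Each `f_r` multiplies the Hilbert series by `1 - z ^ deg f_r`.

For (c) and (e), a `t`-spread monomial divisible by some `f_r` equals it, since no further variable
fits between consecutive members of a residue class. So a lexsegment ideal must have `t - i`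
monomials in degree `k` and `i` in degree `k + 1`. The largest monomial of degree `k` has exactly
`i` multiples in degree `k + 1`; a second monomial adds another multiple as soon as `i ≥ 2`. Thus `t
- i ≤ 1` or `i = 1`, and in these cases the ideal is written down directly. -/

namespace PascalIdeal

open MvPolynomial

/-! ### Products over the fibres of a retraction and differences along it -/

section Retraction

variable {σ : Type*} [DecidableEq σ] {K : Type*} [Field K]

/-- Polynomials as univariate polynomials in the variable `i`. -/
noncomputable def isolate (K : Type*) [Field K] (i : σ) :
    MvPolynomial σ K ≃ₐ[K] Polynomial (MvPolynomial {j // j ≠ i} K) :=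
  (renameEquiv K (Equiv.optionSubtypeNe i).symm).trans (optionEquivLeft K _)

@[simp]
lemma isolate_X_self (i : σ) : isolate K i (X i) = Polynomial.X := by
  simp [isolate]

lemma isolate_X_of_ne {i j : σ} (h : j ≠ i) :
    isolate K i (X j) = Polynomial.C (X ⟨j, h⟩) := by
  simp [isolate, Equiv.optionSubtypeNe_symm_of_ne h]

/-- The polynomials in which the variable `i` does not occur. -/
noncomputable def avoiding (K : Type*) [Field K] (i : σ) : Subalgebra K (MvPolynomial σ K) :=
  ((Polynomial.CAlgHom (R := K) (A := MvPolynomial {j // j ≠ i} K)).range).comap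
    (isolate K i).toAlgHom

lemma mem_avoiding {i : σ} {f : MvPolynomial σ K} :
    f ∈ avoiding K i ↔ ∃ c, Polynomial.C c = isolate K i f := by
  simp [avoiding, Subalgebra.mem_comap]

lemma X_mem_avoiding {i j : σ} (h : j ≠ i) : (X j : MvPolynomial σ K) ∈ avoiding K i :=
  mem_avoiding.2 ⟨_, (isolate_X_of_ne h).symm⟩

lemma aeval_mem_avoiding {i j : σ} (h : j ≠ i) (g : Polynomial K) :
    Polynomial.aeval (X j : MvPolynomial σ K) g ∈ avoiding K i := by
  have := Polynomial.aeval_mem_adjoin_singleton K (X j : MvPolynomial σ K) (p := g)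
  exact Algebra.adjoin_le (by simpa using X_mem_avoiding h) this

/-- A monic polynomial is a nonzerodivisor modulo an ideal generated by constants. -/
theorem mem_span_of_monic_mul_mem {A B : Type*} [CommRing A] [CommRing B] (e : A ≃+* Polynomial B)
    {p : A} (hp : (e p).Monic) {T : Set A} (hT : ∀ g ∈ T, ∃ c, Polynomial.C c = e g) {h : A}
    (hh : p * h ∈ Ideal.span T) : h ∈ Ideal.span T := by
  let J : Ideal B := Ideal.span {c | Polynomial.C c ∈ e '' T}
  have hJ : (Ideal.span T).map (e : A →+* Polynomial B) = J.map Polynomial.C := by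
    rw [Ideal.map_span, Ideal.map_span]
    congr 1
    ext y
    constructor
    · rintro ⟨g, hg, rfl⟩
      obtain ⟨c, hc⟩ := hT g hg
      exact ⟨c, ⟨g, hg, hc.symm⟩, hc⟩
    · rintro ⟨c, hc, rfl⟩
      exact hc
  -- Membership says that all coefficients of `e x` vanish modulo `J`, and a monic polynomial stays
  -- monic, hence regular, over `B ⧸ J`.
  have key (x) : x ∈ Ideal.span T ↔ (e x).map (Ideal.Quotient.mk J) = 0 := by
    have h1 : x ∈ Ideal.span T ↔ e x ∈ (Ideal.span T).map (e : A →+* Polynomial B) := by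
      refine ⟨fun hx => Ideal.mem_map_of_mem (e : A →+* Polynomial B) hx, fun hx => ?_⟩
      obtain ⟨y, hy, hxy⟩ := (Ideal.mem_map_of_equiv e _).1 hx
      rwa [← e.injective hxy]
    rw [h1, hJ, ← Polynomial.coe_mapRingHom, ← RingHom.mem_ker, Polynomial.ker_mapRingHom,
      Ideal.mk_ker]
  rw [key] at hh ⊢
  rw [map_mul, Polynomial.map_mul] at hh
  exact ((hp.map (Ideal.Quotient.mk J)).mul_right_eq_zero_iff).1 hh

variable (ρ : σ → σ)

/-- The product of the variables in the fibre of `ρ` over `r`. -/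
noncomputable def fibreProd [Fintype σ] (K : Type*) [Field K] (r : σ) : MvPolynomial σ K :=
  ∏ j ∈ Finset.univ.filter (ρ · = r), X j

/-- The products over the fibres of `ρ` and polynomials `g j` in the differences `X j - X (ρ j)`. -/
noncomputable def systemOf [Fintype σ] (g : σ → Polynomial K) (j : σ) : MvPolynomial σ K :=
  if ρ j = j then fibreProd ρ K j else Polynomial.aeval (X j - X (ρ j)) (g j)

/-- The coordinate change that takes the differences `X j - X (ρ j)` to `X j`. -/
noncomputable def shear (K : Type*) [Field K] : MvPolynomial σ K →ₐ[K] MvPolynomial σ K :=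
  aeval fun j => if ρ j = j then X j else X j + X (ρ j)

/-- The inverse coordinate change. -/
noncomputable def unshear (K : Type*) [Field K] : MvPolynomial σ K →ₐ[K] MvPolynomial σ K :=
  aeval fun j => if ρ j = j then X j else X j - X (ρ j)

variable {ρ}

lemma unshear_shear (hρ : ∀ j, ρ (ρ j) = ρ j) (f : MvPolynomial σ K) :
    unshear ρ K (shear ρ K f) = f := by
  have : (unshear ρ K).comp (shear ρ K) = AlgHom.id K _ := by
    ext1 j
    by_cases h : ρ j = j <;> simp [shear, unshear, h, hρ]
  exact DFunLike.congr_fun this f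

variable [Fintype σ]

lemma shear_systemOf_of_ne (hρ : ∀ j, ρ (ρ j) = ρ j) (g : σ → Polynomial K) {j : σ}
    (h : ρ j ≠ j) : shear ρ K (systemOf ρ g j) = Polynomial.aeval (X j) (g j) := by
  rw [systemOf, if_neg h, ← Polynomial.aeval_algHom_apply]
  simp [shear, h, hρ]

lemma shear_systemOf_of_eq (g : σ → Polynomial K) {r : σ} (h : ρ r = r) :
    shear ρ K (systemOf ρ g r) =
      ∏ j ∈ Finset.univ.filter (ρ · = r), if ρ j = j then X j else X j + X r := by
  rw [systemOf, if_pos h, fibreProd, map_prod]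
  refine Finset.prod_congr rfl fun j hj => ?_
  simp [shear, (Finset.mem_filter.1 hj).2]

/-- After the shear a fibre product involves only the variables of its own fibre, and `g b` only the
variable `b`. So a fixed point `a` occurs in no member but its own. -/
lemma shear_systemOf_mem_avoiding_of_eq (hρ : ∀ j, ρ (ρ j) = ρ j) (g : σ → Polynomial K)
    {a b : σ}
    (ha : ρ a = a) (hab : b ≠ a) : shear ρ K (systemOf ρ g b) ∈ avoiding K a := by
  by_cases hb : ρ b = b
  · rw [shear_systemOf_of_eq g hb]
    refine Subalgebra.prod_mem _ fun j hj => ?_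
    have hj := (Finset.mem_filter.1 hj).2
    have hja : j ≠ a := by rintro rfl; exact hab (hj.symm.trans ha)
    split_ifs
    · exact X_mem_avoiding hja
    · exact add_mem (X_mem_avoiding hja) (X_mem_avoiding hab)
  · rw [shear_systemOf_of_ne hρ g hb]
    exact aeval_mem_avoiding hab _

/-- Over a fixed `a` the sheared product is `X a * ∏ (X j + X a)`, a product of monic linear factors
in `X a`; over any other `a` it is `g a` evaluated at `X a`. -/
lemma monic_isolate_shear_systemOf (hρ : ∀ j, ρ (ρ j) = ρ j) {g : σ → Polynomial K}
    (hg : ∀ j, (g j).Monic) (a : σ) : (isolate K a (shear ρ K (systemOf ρ g a))).Monic := by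
  by_cases ha : ρ a = a
  · rw [shear_systemOf_of_eq g ha, map_prod]
    refine Polynomial.monic_prod_of_monic _ _ fun j hj => ?_
    have hj := (Finset.mem_filter.1 hj).2
    by_cases hja : j = a
    · subst hja
      simp [ha, Polynomial.monic_X]
    · have : ρ j ≠ j := by rw [hj]; exact Ne.symm hja
      rw [if_neg this, map_add, isolate_X_self, isolate_X_of_ne hja, add_comm]
      exact Polynomial.monic_X_add_C _
  · have h := Polynomial.aeval_algHom_apply (isolate K a).toAlgHom (X a) (g a)
    rw [AlgEquiv.toAlgHom_apply, AlgEquiv.toAlgHom_apply, isolate_X_self,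
      Polynomial.aeval_X_left_eq_map] at h
    rw [shear_systemOf_of_ne hρ g ha, ← h]
    exact (hg a).map _

/-- The one-variable criterion is applied in the sheared coordinates, and `unshear` carries the
conclusion back. -/
lemma mem_span_of_shear (hρ : ∀ j, ρ (ρ j) = ρ j) {g : σ → Polynomial K}
    (hg : ∀ j, (g j).Monic) {a : σ} {s : Set σ}
    (hs : ∀ b ∈ s, shear ρ K (systemOf ρ g b) ∈ avoiding K a) {h : MvPolynomial σ K}
    (hh : systemOf ρ g a * h ∈ Ideal.span (systemOf ρ g '' s)) :
    h ∈ Ideal.span (systemOf ρ g '' s) := by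
  have h1 := Ideal.mem_map_of_mem (shear ρ K) hh
  rw [Ideal.map_span, map_mul] at h1
  have h2 := mem_span_of_monic_mul_mem (isolate K a).toRingEquiv
    (monic_isolate_shear_systemOf hρ hg a)
    (by rintro _ ⟨_, ⟨b, hb, rfl⟩, rfl⟩; exact mem_avoiding.1 (hs b hb)) h1
  have h3 := Ideal.mem_map_of_mem (unshear ρ K) h2
  rw [Ideal.map_span, unshear_shear hρ] at h3
  convert h3 using 2
  rw [Set.image_image, Set.image_image]
  simp only [unshear_shear hρ]

/-- Each member of `systemOf ρ g` is a nonzerodivisor modulo any of the others. -/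
theorem mem_span_of_systemOf_mul_mem (hρ : ∀ j, ρ (ρ j) = ρ j) {g : σ → Polynomial K}
    (hg : ∀ j, (g j).Monic) {a : σ} {s : Finset σ} (ha : a ∉ s) {h : MvPolynomial σ K}
    (hh : systemOf ρ g a * h ∈ Ideal.span (systemOf ρ g '' s)) :
    h ∈ Ideal.span (systemOf ρ g '' s) := by
  by_cases hfix : ρ a = a
  · exact mem_span_of_shear hρ hg (fun b hb => shear_systemOf_mem_avoiding_of_eq hρ g hfix
      (by rintro rfl; exact ha hb)) hh
  -- For `a` not fixed, the product over `ρ a` involves `X a`, so the fixed points of `s` are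
  -- removed one at a time. With `b` fixed and `A`, `B` the members at `a`, `b`, a relation `A * h ≡
  -- c * B` modulo the rest gives `c ≡ e * A`, because `B` is regular modulo the rest and `A`. Then
  -- `A * (h - e * B)` lies in the smaller ideal.
  induction hm : (s.filter fun j => ρ j = j).card generalizing s h with
  | zero =>
    refine mem_span_of_shear hρ hg (fun b hb => ?_) hh
    rw [shear_systemOf_of_ne hρ g]
    · exact aeval_mem_avoiding (by rintro rfl; exact ha hb) _
    · intro hb'
      rw [Finset.card_eq_zero] at hm
      exact Finset.notMem_empty b (hm ▸ Finset.mem_filter.2 ⟨hb, hb'⟩)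
  | succ m ih =>
    obtain ⟨b, hb⟩ : (s.filter fun j => ρ j = j).Nonempty := by
      rw [← Finset.card_pos]; omega
    obtain ⟨hbs, hbfix⟩ := Finset.mem_filter.1 hb
    have hba : b ≠ a := by rintro rfl; exact ha hbs
    set s' := s.erase b with hs'
    have hcard : (s'.filter fun j => ρ j = j).card = m := by
      rw [hs', Finset.filter_erase, Finset.card_erase_of_mem hb]; omega
    have has' : a ∉ s' := fun h => ha (Finset.mem_of_mem_erase h)
    have hspan : Ideal.span (systemOf ρ g '' s) =
        Ideal.span {systemOf ρ g b} ⊔ Ideal.span (systemOf ρ g '' s') := by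
      rw [← Ideal.span_union, ← Finset.insert_erase hbs, Finset.coe_insert, Set.image_insert_eq,
        Set.insert_eq]
    rw [hspan] at hh ⊢
    obtain ⟨c, τ, hτ, hc⟩ := Ideal.mem_span_singleton_sup.1 hh
    have hspan2 : Ideal.span (systemOf ρ g '' ↑(insert a s')) =
        Ideal.span {systemOf ρ g a} ⊔ Ideal.span (systemOf ρ g '' s') := by
      rw [← Ideal.span_union, Finset.coe_insert, Set.image_insert_eq, Set.insert_eq]
    have h1 : c ∈ Ideal.span (systemOf ρ g '' ↑(insert a s')) := by
      refine mem_span_of_shear hρ hg (a := b) (fun j hj => shear_systemOf_mem_avoiding_of_eq hρ g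
        hbfix ?_) ?_
      · rintro rfl
        rcases Finset.mem_insert.1 hj with h | h
        · exact hba h
        · exact Finset.notMem_erase _ _ h
      · rw [hspan2]
        refine Ideal.mem_span_singleton_sup.2 ⟨h, -τ, neg_mem hτ, ?_⟩
        linear_combination -hc
    rw [hspan2] at h1
    obtain ⟨e, τ', hτ', he⟩ := Ideal.mem_span_singleton_sup.1 h1
    have h2 : h - e * systemOf ρ g b ∈ Ideal.span (systemOf ρ g '' s') := by
      refine ih has' ?_ hcard
      have : systemOf ρ g a * (h - e * systemOf ρ g b) = τ + systemOf ρ g b * τ' := by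
        linear_combination -hc - systemOf ρ g b * he
      rw [this]
      exact add_mem hτ (Ideal.mul_mem_left _ _ hτ')
    exact Ideal.mem_span_singleton_sup.2 ⟨e, _, h2, by ring⟩

end Retraction

end PascalIdeal

namespace PascalIdeal

open MvPolynomial RingTheory.Sequence

/-! ### Regular sequences on quotients -/

section WeaklyRegular

variable {R : Type*} [CommRing R]

lemma mk_mem_smul_top_iff (I J : Ideal R) (x : R) :
    (Submodule.Quotient.mk x : R ⧸ J) ∈ (I • ⊤ : Submodule R (R ⧸ J)) ↔ x ∈ I ⊔ J := by
  have := Submodule.comap_smul_top_of_surjective I (Submodule.mkQ J) (Submodule.mkQ_surjective J)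
  rw [Submodule.ker_mkQ, smul_eq_mul, Ideal.mul_top] at this
  rw [← this]
  rfl

theorem isWeaklyRegular_quotient_iff (J : Ideal R) (rs : List R) :
    IsWeaklyRegular (R ⧸ J) rs ↔ ∀ i (h : i < rs.length), ∀ x,
      rs[i] * x ∈ Ideal.ofList (rs.take i) ⊔ J → x ∈ Ideal.ofList (rs.take i) ⊔ J := by
  rw [isWeaklyRegular_iff]
  refine forall₂_congr fun i h => ?_
  rw [isSMulRegular_quotient_iff_mem_of_smul_mem, (Submodule.mkQ_surjective J).forall]
  refine forall_congr' fun x => ?_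
  rw [← map_smul, Submodule.mkQ_apply, Submodule.mkQ_apply, mk_mem_smul_top_iff,
    mk_mem_smul_top_iff, smul_eq_mul]

/-- A nonzerodivisor on `M` avoids the minimal primes of the support, so each member of the sequence
lowers the dimension by at least one. Properness of the quotient is not needed for this inequality.
-/
theorem supportDim_quotient_add_length_le [IsNoetherianRing R] (M : Type*) [AddCommGroup M]
    [Module R M] [Module.Finite R M] (rs : List R) (h : IsWeaklyRegular M rs) :
    Module.supportDim R (M ⧸ (Ideal.ofList rs • ⊤ : Submodule R M)) + rs.length ≤
      Module.supportDim R M := by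
  induction rs generalizing M with
  | nil =>
    rw [Ideal.ofList_nil, Submodule.bot_smul]
    simpa using (Module.supportDim_eq_of_equiv (Submodule.quotEquivOfEqBot ⊥ rfl)).le
  | cons x rs ih =>
    rw [isWeaklyRegular_cons_iff] at h
    rw [Module.supportDim_eq_of_equiv
      (Submodule.quotOfListConsSMulTopEquivQuotSMulTopInner M x rs), List.length_cons, Nat.cast_succ,
      ← add_assoc]
    exact (add_le_add_left (ih _ h.2) 1).trans
      (Module.supportDim_quotSMulTop_succ_le_of_notMem_minimalPrimes
        fun _ => h.1.notMem_of_mem_minimalPrimes)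

theorem moduleDepth_le_ringKrullDim (R : Type*) [CommRing R] [IsNoetherianRing R]
    [IsLocalRing R] :
    ((moduleDepth (IsLocalRing.maximalIdeal R) R : ℕ∞) : WithBot ℕ∞) ≤ ringKrullDim R := by
  obtain ⟨d, hd⟩ := WithBot.ne_bot_iff_exists.1 (ringKrullDim_ne_bot (R := R))
  rw [← hd]
  refine WithBot.coe_le_coe.2 (sSup_le ?_)
  rintro _ ⟨rs, -, hrs, rfl⟩
  have h2 := ringKrullDim_add_length_eq_ringKrullDim_of_isRegular rs hrs
  have : Nontrivial (R ⧸ Ideal.ofList rs) := by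
    refine Ideal.Quotient.nontrivial_iff.2 fun h => hrs.top_ne_smul ?_
    rw [h, smul_eq_mul, Ideal.mul_top]
  have h3 : 0 ≤ ringKrullDim (R ⧸ Ideal.ofList rs) := ringKrullDim_nonneg_of_nontrivial
  obtain ⟨c, hc⟩ := WithBot.ne_bot_iff_exists.1
    (show ringKrullDim (R ⧸ Ideal.ofList rs) ≠ ⊥ from fun h => by simp [h] at h3)
  rw [← hd, ← hc] at h2
  have h5 : c + rs.length = d := by exact_mod_cast h2
  rw [← h5]
  exact le_add_self

end WeaklyRegular

/-! ### Cohen–Macaulayness of the quotient by fibre products -/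

section CohenMacaulay

variable {σ : Type*} [DecidableEq σ] {K : Type*} [Field K] {ρ : σ → σ} [Fintype σ]

theorem isWeaklyRegular_systemOf (hρ : ∀ j, ρ (ρ j) = ρ j) {g : σ → Polynomial K}
    (hg : ∀ j, (g j).Monic) (s : Finset σ) {l : List σ} (hl : l.Nodup) (hs : ∀ a ∈ l, a ∉ s) :
    IsWeaklyRegular (MvPolynomial σ K ⧸ Ideal.span (systemOf ρ g '' s))
      (l.map (systemOf ρ g)) := by
  rw [isWeaklyRegular_quotient_iff]
  intro i hi x hx
  have hi' : i < l.length := by simpa using hi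
  have hspan : Ideal.ofList ((l.map (systemOf ρ g)).take i) ⊔ Ideal.span (systemOf ρ g '' s) =
      Ideal.span (systemOf ρ g '' ↑((l.take i).toFinset ∪ s)) := by
    rw [Ideal.ofList, ← Ideal.span_union, Finset.coe_union, Set.image_union]
    congr 2
    ext y
    simp [← List.map_take]
  rw [hspan] at hx ⊢
  rw [List.getElem_map] at hx
  refine mem_span_of_systemOf_mul_mem hρ hg ?_ hx
  rw [Finset.mem_union, not_or]
  refine ⟨fun h => ?_, hs _ (List.getElem_mem hi')⟩
  rw [List.mem_toFinset, List.mem_take_iff_getElem] at h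
  obtain ⟨m, hm, h⟩ := h
  have := (hl.getElem_inj_iff).1 h
  omega

/-- The ideal generated by the products of the variables in the fibres of `ρ`. -/
noncomputable def fibreIdeal (ρ : σ → σ) (K : Type*) [Field K] : Ideal (MvPolynomial σ K) :=
  Ideal.span (fibreProd ρ K '' {r | ρ r = r})

lemma span_systemOf_fixed (g : σ → Polynomial K) :
    Ideal.span (systemOf ρ g '' ↑(Finset.univ.filter fun r => ρ r = r)) = fibreIdeal ρ K := by
  rw [fibreIdeal]
  congr 1
  refine Set.EqOn.image_eq_self (f := id) (fun _ _ => rfl) |>.symm.trans ?_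
  rw [Set.image_id, Finset.coe_filter_univ]
  exact Set.image_congr fun r hr => if_pos hr

/-- The fibre products form a weakly regular sequence on the polynomial ring, with one member for
each fixed point; the remaining dimension is at most the number of non-fixed indices. -/
lemma ringKrullDim_quotient_fibreIdeal_le (hρ : ∀ j, ρ (ρ j) = ρ j) :
    ringKrullDim (MvPolynomial σ K ⧸ fibreIdeal ρ K) ≤
      ((Finset.univ.filter fun j => ρ j ≠ j).card : ℕ) := by
  have h := isWeaklyRegular_systemOf (K := K) hρ (g := fun _ => Polynomial.X)
    (fun _ => Polynomial.monic_X) ∅ (l := (Finset.univ.filter fun r => ρ r = r).toList)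
    (Finset.nodup_toList _) (by simp)
  rw [Finset.coe_empty, Set.image_empty, Ideal.span_empty] at h
  rw [(Submodule.quotEquivOfEqBot (⊥ : Ideal (MvPolynomial σ K)) rfl).isWeaklyRegular_congr] at h
  have h1 := supportDim_quotient_add_length_le _ _ h
  have h2 : Ideal.ofList ((Finset.univ.filter fun r => ρ r = r).toList.map
      (systemOf ρ fun _ => (Polynomial.X : Polynomial K))) = fibreIdeal ρ K := by
    rw [← span_systemOf_fixed (fun _ => Polynomial.X)]
    rw [Ideal.ofList]
    congr 1
    ext y
    simp
  rw [h2, smul_eq_mul, Ideal.mul_top, Module.supportDim_quotient_eq_ringKrullDim,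
    Module.supportDim_self_eq_ringKrullDim, MvPolynomial.ringKrullDim_of_isNoetherianRing,
    ringKrullDim_eq_zero_of_field, zero_add, List.length_map, Finset.length_toList,
    Nat.card_eq_fintype_card] at h1
  have h3 := Finset.card_filter_add_card_filter_not (s := (Finset.univ : Finset σ))
    (fun r => ρ r = r)
  rw [Finset.card_univ] at h3
  rw [← h3, Nat.cast_add, add_comm] at h1
  rcases eq_or_ne (ringKrullDim (MvPolynomial σ K ⧸ fibreIdeal ρ K)) ⊥ with h4 | h4
  · simp [h4]
  · obtain ⟨c, hc⟩ := WithBot.ne_bot_iff_exists.1 h4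
    rw [← hc] at h1 ⊢
    have h5 : ((Finset.univ.filter fun j => ρ j = j).card : ℕ∞) + c ≤
      (Finset.univ.filter fun j => ρ j = j).card + (Finset.univ.filter fun j => ¬ρ j = j).card := by
      exact_mod_cast h1
    exact_mod_cast (ENat.add_le_add_iff_left (ENat.natCast_ne_top _)).1 h5

/-- The products of the variables in the fibres of `ρ` define a Cohen–Macaulay ring. -/
theorem isCohenMacaulayRing_quotient_fibreIdeal (hρ : ∀ j, ρ (ρ j) = ρ j) :
    IsCohenMacaulayRing (MvPolynomial σ K ⧸ fibreIdeal ρ K) where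
  isNoetherianRing := inferInstance
  depth_eq_dim p hp := by
    let R := MvPolynomial σ K ⧸ fibreIdeal ρ K
    let Rp := Localization.AtPrime p
    let : Field (R ⧸ p) := Ideal.Quotient.field p
    have hfin : Module.Finite K (R ⧸ p) := finite_of_finite_type_of_isJacobsonRing K (R ⧸ p)
    -- By the Nullstellensatz `R ⧸ p` is finite over `K`. So each difference has a minimal
    -- polynomial there, and the value of that polynomial at the difference lies in `p`.
    let θ : σ → R ⧸ p := fun j =>
      Ideal.Quotient.mk p (Ideal.Quotient.mk (fibreIdeal ρ K) (X j - X (ρ j)))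
    let g : σ → Polynomial K := fun j => minpoly K (θ j)
    have hg (j) : (g j).Monic := minpoly.monic (Algebra.IsIntegral.isIntegral _)
    let l := (Finset.univ.filter fun r => ρ r ≠ r).toList
    have h1 : IsWeaklyRegular R (l.map (systemOf ρ g)) := by
      have := isWeaklyRegular_systemOf (K := K) hρ hg (Finset.univ.filter fun r => ρ r = r)
        (l := l) (Finset.nodup_toList _) (by simp [l])
      rwa [span_systemOf_fixed] at this
    rw [← isWeaklyRegular_map_algebraMap_iff R R] at h1
    have hmem : ∀ r ∈ (l.map (systemOf ρ g)).map (algebraMap (MvPolynomial σ K) R), r ∈ p := by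
      intro r hr
      simp only [List.mem_map, l, Finset.mem_toList, Finset.mem_filter] at hr
      obtain ⟨_, ⟨j, ⟨-, hj⟩, rfl⟩, rfl⟩ := hr
      rw [systemOf, if_neg hj]
      have h := minpoly.aeval K (θ j)
      have e : θ j = ((Ideal.Quotient.mkₐ K p).comp (Ideal.Quotient.mkₐ K (fibreIdeal ρ K)))
        (X j - X (ρ j)) := rfl
      rw [e, Polynomial.aeval_algHom_apply] at h
      exact Ideal.Quotient.eq_zero_iff_mem.1 h
    have hreg := h1.isRegular_of_isLocalization_of_mem Rp p hmem
    have hdim : ringKrullDim Rp ≤ l.length := by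
      refine (IsLocalization.AtPrime.ringKrullDim_eq_height p Rp).le.trans
        ((Ideal.height_le_ringKrullDim_of_ne_top hp.ne_top).trans ?_)
      simpa [l] using ringKrullDim_quotient_fibreIdeal_le (K := K) hρ
    have hle : (l.length : WithBot ℕ∞) ≤
        ((moduleDepth (R := Rp) (IsLocalRing.maximalIdeal Rp) Rp : ℕ∞) : WithBot ℕ∞) := by
      have : (l.length : ℕ∞) ≤ moduleDepth (R := Rp) (IsLocalRing.maximalIdeal Rp) Rp := by
        refine le_sSup ⟨_, ?_, hreg, by simp⟩
        intro r hr
        obtain ⟨s, hs, rfl⟩ := List.mem_map.1 hr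
        exact (IsLocalization.AtPrime.to_map_mem_maximal_iff Rp p s).2 (hmem s hs)
      exact_mod_cast this
    refine le_antisymm ?_ (hdim.trans hle)
    exact moduleDepth_le_ringKrullDim Rp

end CohenMacaulay

end PascalIdeal

namespace PascalIdeal

open MvPolynomial RingTheory.Sequence

/-! ### Depth of an ideal -/

section IdealRegular

variable {R : Type*} [CommRing R]

theorem isWeaklyRegular_ideal_iff (I : Ideal R) (rs : List R) :
    IsWeaklyRegular I rs ↔ ∀ i (h : i < rs.length), ∀ x ∈ I,
      rs[i] * x ∈ Ideal.ofList (rs.take i) * I → x ∈ Ideal.ofList (rs.take i) * I := by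
  rw [isWeaklyRegular_iff]
  refine forall₂_congr fun i h => ?_
  rw [isSMulRegular_quotient_iff_mem_of_smul_mem, Subtype.forall]
  refine forall₂_congr fun x hx => ?_
  rw [Submodule.mem_smul_top_iff, Submodule.mem_smul_top_iff]
  rfl

/-- This is `(rs) ∩ I = (rs) * I`, the vanishing of `Tor₁` of `R ⧸ (rs)` and `R ⧸ I`. If `a + c * r
∈ I` with `a` in the ideal of the earlier members, then regularity of `r` modulo `I` replaces `c` by
an element of `I`, up to a term absorbed in `a`. -/
lemma mem_ofList_mul_of_isWeaklyRegular {I : Ideal R} {rs : List R}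
    (h : IsWeaklyRegular (R ⧸ I) rs) (i : ℕ) (hi : i ≤ rs.length) {x : R} (hx : x ∈ I)
    (hxi : x ∈ Ideal.ofList (rs.take i)) : x ∈ Ideal.ofList (rs.take i) * I := by
  rw [isWeaklyRegular_quotient_iff] at h
  induction i generalizing x with
  | zero =>
    rw [List.take_zero, Ideal.ofList_nil] at hxi
    rw [(Submodule.mem_bot R).1 hxi]
    exact zero_mem _
  | succ i ih =>
    rw [← List.take_concat_get' rs i hi, Ideal.ofList_append, Ideal.ofList_singleton] at hxi ⊢
    obtain ⟨a, ha, b, hb, rfl⟩ := Submodule.mem_sup.1 hxi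
    obtain ⟨c, rfl⟩ := Ideal.mem_span_singleton'.1 hb
    have hc : c ∈ Ideal.ofList (rs.take i) ⊔ I := by
      refine h i hi c ?_
      have : rs[i] * c = -a + (a + c * rs[i]) := by ring
      rw [this]
      exact add_mem (Ideal.mem_sup_left (neg_mem ha)) (Ideal.mem_sup_right hx)
    obtain ⟨e, he, c', hc', rfl⟩ := Submodule.mem_sup.1 hc
    have h1 : a + e * rs[i] ∈ Ideal.ofList (rs.take i) * I := by
      refine ih (by omega) ?_ (add_mem ha (Ideal.mul_mem_right _ _ he))
      have : a + e * rs[i] = (a + (e + c') * rs[i]) - c' * rs[i] := by ring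
      rw [this]
      exact sub_mem hx (Ideal.mul_mem_right _ _ hc')
    have : a + (e + c') * rs[i] = (a + e * rs[i]) + rs[i] * c' := by ring
    rw [this]
    exact add_mem (Ideal.mul_mono_left le_sup_left h1)
      (Ideal.mul_mem_mul (Ideal.mem_sup_right (Ideal.mem_span_singleton_self _)) hc')

theorem isWeaklyRegular_self_iff (rs : List R) :
    IsWeaklyRegular R rs ↔ ∀ i (h : i < rs.length), ∀ x,
      rs[i] * x ∈ Ideal.ofList (rs.take i) → x ∈ Ideal.ofList (rs.take i) := by
  rw [isWeaklyRegular_iff]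
  refine forall₂_congr fun i h => ?_
  rw [isSMulRegular_quotient_iff_mem_of_smul_mem]
  simp only [smul_eq_mul, Ideal.mul_top]

/-- Regularity on `R` puts `x` in `(rs'.take i) ∩ I`, which equals `(rs'.take i) * I` as long as
only members of `rs` are taken. The last element `y` is never among them, so it need not be regular
on `R ⧸ I`; this is why `I` has depth one more than `R ⧸ I`. -/
theorem isWeaklyRegular_ideal_append {I : Ideal R} {rs rs' : List R} {y : R}
    (h : IsWeaklyRegular (R ⧸ I) rs) (hrs : rs' = rs ++ [y])
    (h' : IsWeaklyRegular R rs') : IsWeaklyRegular I rs' := by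
  rw [isWeaklyRegular_self_iff] at h'
  refine (isWeaklyRegular_ideal_iff I _).2 fun i hi x hx hix => ?_
  have hi' : i ≤ rs.length := by
    rw [hrs, List.length_append, List.length_singleton] at hi; omega
  have hle : Ideal.ofList (rs'.take i) * I ≤ Ideal.ofList (rs'.take i) := Ideal.mul_le_left
  have h1 : x ∈ Ideal.ofList (rs'.take i) := h' i hi x (hle hix)
  have ht : rs'.take i = rs.take i := by rw [hrs, List.take_append_of_le_length hi']
  rw [ht] at h1 ⊢
  exact mem_ofList_mul_of_isWeaklyRegular h i hi' hx h1

end IdealRegular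

/-! ### Maximality of a regular sequence via `Ext` -/

section Ext

universe u

open CategoryTheory Abelian

variable {R : Type u} [CommRing R]

/-- Dimension shifting: in the long exact sequence of `0 → M → M → M/aM → 0`, the group `Ext^i(N,
M/aM)` sits between `Ext^i(N, M)` and `Ext^(i+1)(N, M)`. Each member of `z` costs one degree, until
only `Hom` is left. -/
lemma subsingleton_linearMap_of_subsingleton_ext (N M : ModuleCat.{u} R) (z : List R)
    (hz : IsWeaklyRegular M z) (h : ∀ i ≤ z.length, Subsingleton (Ext N M i)) :
    Subsingleton (N →ₗ[R] M ⧸ (Ideal.ofList z • ⊤ : Submodule R M)) := by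
  induction z generalizing M with
  | nil =>
    have h0 := h 0 le_rfl
    have h1 : Subsingleton (N →ₗ[R] M) :=
      (Ext.addEquiv₀.trans ModuleCat.homAddEquiv).symm.subsingleton
    have e : (M ⧸ (Ideal.ofList ([] : List R) • ⊤ : Submodule R M)) ≃ₗ[R] M :=
      Submodule.quotEquivOfEqBot _ (by rw [Ideal.ofList_nil, Submodule.bot_smul])
    exact (LinearEquiv.congrRight e : (N →ₗ[R] _) ≃ₗ[R] (N →ₗ[R] M)).toEquiv.subsingleton
  | cons a z ih =>
    rw [isWeaklyRegular_cons_iff] at hz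
    have h1 : ∀ i ≤ z.length, Subsingleton (Ext N (ModuleCat.of R (QuotSMulTop a M)) i) := by
      intro i hi
      have zero1 := AddCommGrpCat.isZero_of_iff_subsingleton.mpr
        (h i (by rw [List.length_cons]; omega))
      have zero2 := AddCommGrpCat.isZero_of_iff_subsingleton.mpr
        (h (i + 1) (by rw [List.length_cons]; omega))
      exact AddCommGrpCat.subsingleton_of_isZero <| ShortComplex.Exact.isZero_of_both_zeros
        ((Ext.covariant_sequence_exact₃' N hz.1.smulShortComplex_shortExact) i (i + 1) rfl)
        (zero1.eq_zero_of_src _) (zero2.eq_zero_of_tgt _)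
    have h2 := ih (ModuleCat.of R (QuotSMulTop a M)) hz.2 h1
    exact (LinearEquiv.congrRight (Submodule.quotOfListConsSMulTopEquivQuotSMulTopInner M a z) :
      (N →ₗ[R] _) ≃ₗ[R] (N →ₗ[R] _)).toEquiv.subsingleton

/-- A regular sequence with a socle element modulo it has maximal length. -/
theorem moduleDepth_eq_length_of_socle [IsNoetherianRing R] (J : Ideal R) (M : Type u)
    [AddCommGroup M] [Module R M] [Module.Finite R M] {z : List R} (hzJ : ∀ r ∈ z, r ∈ J)
    (hz : IsWeaklyRegular M z) {u : M} (hu : u ∉ (Ideal.ofList z • ⊤ : Submodule R M))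
    (hJu : ∀ r ∈ J, r • u ∈ (Ideal.ofList z • ⊤ : Submodule R M)) :
    moduleDepth J M = z.length := by
  have hreg : IsRegular M z := ⟨hz, fun h => hu (h ▸ Submodule.mem_top)⟩
  refine le_antisymm (sSup_le ?_) (le_sSup ⟨z, hzJ, hreg, rfl⟩)
  rintro _ ⟨rs, hrsJ, hrs, rfl⟩
  by_contra! hlt
  have hlt : z.length < rs.length := by exact_mod_cast hlt
  -- If `J • M = M`, some `a` with `a - 1 ∈ J` annihilates `M`. Then `(a - 1) • u = -u` would lie in
  -- `(z) • M`.
  have hJ : J • (⊤ : Submodule R M) < ⊤ := by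
    refine lt_top_iff_ne_top.2 fun htop => ?_
    obtain ⟨a, ha, ha'⟩ := Submodule.exists_sub_one_mem_and_smul_eq_zero_of_fg_of_le_smul J
      (⊤ : Submodule R M) (Module.Finite.fg_top) htop.ge
    have h1 := hJu _ ha
    rw [sub_smul, one_smul, ha' u Submodule.mem_top, zero_sub] at h1
    exact hu ((Submodule.neg_mem_iff _).1 h1)
  have hsupp : Module.support R (R ⧸ J) ⊆ PrimeSpectrum.zeroLocus J := by
    rw [Module.support_eq_zeroLocus, Ideal.annihilator_quotient]
  have hext := ModuleCat.subsingleton_ext_of_exists_isRegular J (ModuleCat.of R (R ⧸ J)) hsupp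
    (ModuleCat.of R M) hJ rs hrsJ hrs
  have hsub := subsingleton_linearMap_of_subsingleton_ext (ModuleCat.of R (R ⧸ J))
    (ModuleCat.of R M) z hz fun i hi => hext i (by omega)
  -- A regular sequence longer than `z` forces `Hom(R/J, M/zM) = 0`, whereas `1 ↦ u` is a nonzero
  -- map.
  let Q := M ⧸ (Ideal.ofList z • ⊤ : Submodule R M)
  let φ : (R ⧸ J) →ₗ[R] Q := Submodule.liftQ J
    (LinearMap.toSpanSingleton R Q (Submodule.Quotient.mk u)) fun r hr => by
      rw [LinearMap.mem_ker, LinearMap.toSpanSingleton_apply, ← Submodule.Quotient.mk_smul,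
        Submodule.Quotient.mk_eq_zero]
      exact hJu r hr
  have h1 : φ (Submodule.Quotient.mk 1) = 0 := by
    have : φ = 0 := @Subsingleton.elim _ hsub _ _
    rw [this, LinearMap.zero_apply]
  rw [Submodule.liftQ_apply, LinearMap.toSpanSingleton_apply, one_smul,
    Submodule.Quotient.mk_eq_zero] at h1
  exact hu h1

end Ext

/-! ### The depth of the ideal of fibre products -/

section FibreIdeal

variable {σ : Type*} [DecidableEq σ] {K : Type*} [Field K] {ρ : σ → σ}

lemma prod_X_pow_notMem (s : Finset σ) (d : σ → ℕ) (hd : ∀ r ∈ s, 0 < d r) :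
    ∏ r ∈ s, (X r : MvPolynomial σ K) ^ (d r - 1) ∉
      Ideal.span ((fun r => (X r : MvPolynomial σ K) ^ d r) '' s) := by
  have h1 : ∏ r ∈ s, (X r : MvPolynomial σ K) ^ (d r - 1) =
      monomial (∑ r ∈ s, Finsupp.single r (d r - 1)) 1 := by
    rw [monomial_sum_one]
    exact Finset.prod_congr rfl fun r _ => X_pow_eq_monomial
  have h2 : (fun r => (X r : MvPolynomial σ K) ^ d r) '' s =
      (fun m => monomial m (1 : K)) '' ((fun r => Finsupp.single r (d r)) '' s) := by
    rw [Set.image_image]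
    exact Set.image_congr fun r _ => X_pow_eq_monomial
  rw [h1, h2, mem_ideal_span_monomial_image]
  push Not
  refine ⟨∑ r ∈ s, Finsupp.single r (d r - 1), by simp [mem_support_iff], ?_⟩
  rintro _ ⟨r, hr, rfl⟩ hle
  have hr : r ∈ s := hr
  have := hle r
  rw [Finsupp.single_eq_same, Finsupp.finsetSum_apply, Finset.sum_eq_single r
    (fun b _ hb => Finsupp.single_eq_of_ne hb.symm) (fun h => absurd hr h),
    Finsupp.single_eq_same] at this
  have := hd r hr
  omega

variable [Fintype σ]

/-- The substitution `X j ↦ X (ρ j)`. -/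
noncomputable def collapse (ρ : σ → σ) (K : Type*) [Field K] :
    MvPolynomial σ K →ₐ[K] MvPolynomial σ K :=
  aeval fun j => X (ρ j)

/-- The list of the differences `X j - X (ρ j)`, `ρ j ≠ j`. -/
noncomputable def differences (ρ : σ → σ) (K : Type*) [Field K] : List (MvPolynomial σ K) :=
  (Finset.univ.filter fun r => ρ r ≠ r).toList.map (systemOf ρ fun _ => Polynomial.X)

lemma mem_differences {f : MvPolynomial σ K} :
    f ∈ differences ρ K ↔ ∃ j, ρ j ≠ j ∧ X j - X (ρ j) = f := by
  simp only [differences, List.mem_map, Finset.mem_toList, Finset.mem_filter, Finset.mem_univ,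
    true_and]
  refine exists_congr fun j => and_congr_right fun hj => ?_
  rw [systemOf, if_neg hj, Polynomial.aeval_X]

lemma X_sub_X_mem_ofList_differences (j : σ) :
    (X j - X (ρ j) : MvPolynomial σ K) ∈ Ideal.ofList (differences ρ K) := by
  by_cases h : ρ j = j
  · rw [h, sub_self]
    exact zero_mem _
  · exact Ideal.subset_span (mem_differences.2 ⟨j, h, rfl⟩)

lemma sub_collapse_mem (f : MvPolynomial σ K) :
    f - collapse ρ K f ∈ Ideal.ofList (differences ρ K) := by
  rw [← Ideal.Quotient.eq]
  have : (Ideal.Quotient.mkₐ K (Ideal.ofList (differences ρ K))) =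
      (Ideal.Quotient.mkₐ K _).comp (collapse ρ K) := by
    ext1 j
    simp only [AlgHom.comp_apply, collapse, aeval_X]
    exact Ideal.Quotient.eq.2 (X_sub_X_mem_ofList_differences j)
  exact DFunLike.congr_fun this f

lemma collapse_eq_zero_iff (hρ : ∀ j, ρ (ρ j) = ρ j) (f : MvPolynomial σ K) :
    collapse ρ K f = 0 ↔ f ∈ Ideal.ofList (differences ρ K) := by
  constructor
  · intro h
    simpa [h] using sub_collapse_mem (ρ := ρ) f
  · intro h
    have : Ideal.ofList (differences ρ K) ≤ RingHom.ker (collapse ρ K) := by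
      refine Ideal.span_le.2 fun g hg => ?_
      obtain ⟨j, -, rfl⟩ := mem_differences.1 hg
      simp [collapse, hρ]
    exact this h

lemma collapse_fibreProd (r : σ) :
    collapse ρ K (fibreProd ρ K r) = X r ^ (Finset.univ.filter (ρ · = r)).card := by
  rw [fibreProd, map_prod, ← Finset.prod_const]
  refine Finset.prod_congr rfl fun j hj => ?_
  rw [collapse, aeval_X, (Finset.mem_filter.1 hj).2]

/-- Only the last variable is new. The differences generate the kernel of `collapse`, so modulo them
the ring embeds in a domain, where `X r` becomes the nonzero element `X (ρ r)`. -/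
lemma isWeaklyRegular_differences_append (hρ : ∀ j, ρ (ρ j) = ρ j) (r : σ) :
    IsWeaklyRegular (fibreIdeal ρ K) (differences ρ K ++ [X r]) := by
  have hX : ∀ _ : σ, (Polynomial.X : Polynomial K).Monic := fun _ => Polynomial.monic_X
  refine isWeaklyRegular_ideal_append (y := X r) ?_ rfl ?_
  · have := isWeaklyRegular_systemOf (K := K) hρ hX (Finset.univ.filter fun r => ρ r = r)
      (l := (Finset.univ.filter fun r => ρ r ≠ r).toList) (Finset.nodup_toList _) (by simp)
    rwa [span_systemOf_fixed] at this
  · have := isWeaklyRegular_systemOf (K := K) hρ hX ∅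
      (l := (Finset.univ.filter fun r => ρ r ≠ r).toList) (Finset.nodup_toList _) (by simp)
    rw [Finset.coe_empty, Set.image_empty, Ideal.span_empty,
      (Submodule.quotEquivOfEqBot (⊥ : Ideal (MvPolynomial σ K)) rfl).isWeaklyRegular_congr,
      isWeaklyRegular_self_iff] at this
    rw [isWeaklyRegular_self_iff]
    intro i hi x hx
    rw [List.length_append, List.length_singleton] at hi
    rcases Nat.lt_succ_iff_lt_or_eq.1 hi with h | rfl
    · rw [List.take_append_of_le_length h.le] at hx ⊢
      rw [List.getElem_append_left h] at hx
      exact this i h x hx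
    · rw [List.take_left] at hx ⊢
      rw [List.getElem_concat_length rfl, ← collapse_eq_zero_iff hρ, map_mul, collapse, aeval_X,
        mul_eq_zero, ← collapse] at hx
      exact (collapse_eq_zero_iff hρ x).1 (hx.resolve_left (X_ne_zero _))

/-- Modulo the differences the generators become the powers `X r ^ d r` of independent variables, `d
r` being the fibre sizes. The socle of the resulting Artinian quotient is spanned by `∏ X r ^ (d r -
1)`. Multiplying this by `X r₀` and lifting `X r₀ ^ d r₀` to the fibre product gives an element of
`I` that represents a socle class of `I / Z * I`. -/
theorem moduleDepth_fibreIdeal {n : ℕ} {ρ : Fin n → Fin n} (hρ : ∀ j, ρ (ρ j) = ρ j)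
    {r₀ : Fin n} (hr₀ : ρ r₀ = r₀) :
    moduleDepth (gradedMaximalIdeal n K) (fibreIdeal ρ K) =
      ((Finset.univ.filter fun j => ρ j ≠ j).card + 1 : ℕ) := by
  let S := MvPolynomial (Fin n) K
  let d : Fin n → ℕ := fun r => (Finset.univ.filter (ρ · = r)).card
  let fixed : Finset (Fin n) := Finset.univ.filter fun r => ρ r = r
  let Z := Ideal.ofList (differences ρ K ++ [(X r₀ : S)])
  have hd : ∀ r ∈ fixed, 0 < d r := fun r hr =>
    Finset.card_pos.2 ⟨r, Finset.mem_filter.2 ⟨Finset.mem_univ _, (Finset.mem_filter.1 hr).2⟩⟩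
  have hfix₀ : r₀ ∈ fixed := by simp [fixed, hr₀]
  have hZ : Z = Ideal.ofList (differences ρ K) ⊔ Ideal.span {X r₀} := by
    rw [← Ideal.ofList_singleton, ← Ideal.ofList_append]
  have hΘZ : Ideal.ofList (differences ρ K) ≤ Z := hZ ▸ le_sup_left
  have hXZ : (X r₀ : S) ∈ Z :=
    hZ ▸ Ideal.mem_sup_right (Ideal.mem_span_singleton_self _)
  have hf {r : Fin n} (hr : r ∈ fixed) : fibreProd ρ K r ∈ fibreIdeal ρ K :=
    Ideal.subset_span ⟨r, (Finset.mem_filter.1 hr).2, rfl⟩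
  have hfZ : fibreProd ρ K r₀ ∈ Z := by
    have h1 := hΘZ (sub_collapse_mem (ρ := ρ) (fibreProd ρ K r₀))
    rw [collapse_fibreProd] at h1
    have h2 : (X r₀ : S) ^ d r₀ ∈ Z := Ideal.pow_mem_of_mem _ hXZ _ (hd _ hfix₀)
    exact (sub_add_cancel (fibreProd ρ K r₀) (X r₀ ^ d r₀)) ▸ add_mem h1 h2
  let w : S := ∏ r ∈ fixed.erase r₀, X r ^ (d r - 1)
  let u : fibreIdeal ρ K := ⟨fibreProd ρ K r₀ * w, Ideal.mul_mem_right _ _ (hf hfix₀)⟩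
  have hmul : ∀ j, (X j : S) * (fibreProd ρ K r₀ * w) ∈ Z * fibreIdeal ρ K := by
    intro j
    have h1 : (X j - X (ρ j) : S) * (fibreProd ρ K r₀ * w) ∈ Z * fibreIdeal ρ K :=
      Ideal.mul_mem_mul (hΘZ (X_sub_X_mem_ofList_differences j)) u.2
    suffices h2 : (X (ρ j) : S) * (fibreProd ρ K r₀ * w) ∈ Z * fibreIdeal ρ K by
      have := add_mem h1 h2
      rwa [← add_mul, sub_add_cancel] at this
    have hj : ρ j ∈ fixed := by simp [fixed, hρ]
    generalize ρ j = r at hj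
    by_cases hr : r = r₀
    · subst hr
      exact Ideal.mul_mem_mul hXZ u.2
    -- Here `X r` completes `X r ^ (d r - 1)` to `X r ^ d r`, congruent to the generator over `r`
    -- modulo the differences. In the product of the generators over `r₀` and `r`, the first is used
    -- as an element of `Z`, the second as an element of `I`.
    · let w' : S := ∏ r ∈ (fixed.erase r₀).erase r, X r ^ (d r - 1)
      have hw : (X r : S) * w = X r ^ d r * w' := by
        have : w = X r ^ (d r - 1) * w' :=
          (Finset.mul_prod_erase _ _ (Finset.mem_erase.2 ⟨hr, hj⟩)).symm
        rw [this, ← mul_assoc, ← pow_succ', Nat.sub_add_cancel (hd r hj)]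
      have h3 : (fibreProd ρ K r - X r ^ d r) * (fibreProd ρ K r₀ * w') ∈ Z * fibreIdeal ρ K := by
        refine Ideal.mul_mem_mul (hΘZ ?_) (Ideal.mul_mem_right _ _ (hf hfix₀))
        have := sub_collapse_mem (ρ := ρ) (fibreProd ρ K r)
        rwa [collapse_fibreProd] at this
      have h4 : fibreProd ρ K r₀ * (fibreProd ρ K r * w') ∈ Z * fibreIdeal ρ K :=
        Ideal.mul_mem_mul hfZ (Ideal.mul_mem_right _ _ (hf hj))
      have h5 : (X r : S) * (fibreProd ρ K r₀ * w) = fibreProd ρ K r₀ * (fibreProd ρ K r * w') -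
          (fibreProd ρ K r - X r ^ d r) * (fibreProd ρ K r₀ * w') := by
        linear_combination fibreProd ρ K r₀ * hw
      rw [h5]
      exact sub_mem h4 h3
  have hnot : fibreProd ρ K r₀ * w ∉ Z * fibreIdeal ρ K := by
    intro hmem
    -- `collapse` sends `Z * I` into `(X r₀) * A`. Cancelling `X r₀` in the image of `u` would put
    -- `∏ X r ^ (d r - 1)` in `A`.
    let A : Ideal S := Ideal.span ((fun r => (X r : S) ^ d r) '' fixed)
    have h1 := Ideal.mem_map_of_mem (collapse ρ K) hmem
    have hZ' : Z.map (collapse ρ K) ≤ Ideal.span {X r₀} := by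
      rw [Ideal.map_le_iff_le_comap, hZ, sup_le_iff]
      constructor
      · intro x hx
        rw [Ideal.mem_comap, (collapse_eq_zero_iff hρ x).2 hx]
        exact zero_mem _
      · rw [Ideal.span_singleton_le_iff_mem, Ideal.mem_comap, collapse, aeval_X, hr₀]
        exact Ideal.mem_span_singleton_self _
    have hI' : (fibreIdeal ρ K).map (collapse ρ K) ≤ A := by
      rw [Ideal.map_le_iff_le_comap, fibreIdeal, Ideal.span_le]
      rintro _ ⟨r, hr, rfl⟩
      rw [SetLike.mem_coe, Ideal.mem_comap, collapse_fibreProd]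
      exact Ideal.subset_span ⟨r, by simpa [fixed] using hr, rfl⟩
    rw [Ideal.map_mul] at h1
    obtain ⟨q, hq, hq'⟩ := Ideal.mem_span_singleton_mul.1 (Ideal.mul_mono hZ' hI' h1)
    have hw : collapse ρ K w = w := by
      rw [map_prod]
      refine Finset.prod_congr rfl fun r hr => ?_
      rw [map_pow, collapse, aeval_X, (Finset.mem_filter.1 (Finset.mem_of_mem_erase hr)).2]
    have h2 : (X r₀ : S) * q = X r₀ * ∏ r ∈ fixed, X r ^ (d r - 1) := by
      rw [hq', map_mul, hw, collapse_fibreProd, ← Finset.mul_prod_erase _ _ hfix₀, ← mul_assoc,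
        ← pow_succ', Nat.sub_add_cancel (hd r₀ hfix₀)]
    rw [mul_left_cancel₀ (X_ne_zero r₀) h2] at hq
    exact prod_X_pow_notMem fixed d hd hq
  have hlen : (differences ρ K ++ [(X r₀ : S)]).length =
      (Finset.univ.filter fun j => ρ j ≠ j).card + 1 := by
    simp [differences]
  have hXm (j : Fin n) : (X j : S) ∈ gradedMaximalIdeal n K := Ideal.subset_span ⟨j, rfl⟩
  rw [← hlen]
  refine moduleDepth_eq_length_of_socle _ _ ?_ (isWeaklyRegular_differences_append hρ r₀)
    (u := u) ?_ ?_
  · intro f hf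
    rcases List.mem_append.1 hf with h | h
    · obtain ⟨j, -, rfl⟩ := mem_differences.1 h
      exact sub_mem (hXm _) (hXm _)
    · rw [List.mem_singleton.1 h]
      exact hXm _
  · rw [Submodule.mem_smul_top_iff]
    exact hnot
  · intro f hf
    rw [Submodule.mem_smul_top_iff]
    change f * (fibreProd ρ K r₀ * w) ∈ Z * fibreIdeal ρ K
    induction hf using Submodule.span_induction with
    | mem x hx => obtain ⟨j, rfl⟩ := hx; exact hmul j
    | zero => rw [zero_mul]; exact zero_mem _
    | add x y _ _ hx hy => rw [add_mul]; exact add_mem hx hy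
    | smul a x _ hx => rw [smul_eq_mul, mul_assoc]; exact Ideal.mul_mem_left _ _ hx

end FibreIdeal

end PascalIdeal

namespace PascalIdeal

open MvPolynomial

/-! ### Homogeneous components -/

section HomogeneousComponent

variable {σ : Type*} {R : Type*} [CommRing R]

attribute [local instance] MvPolynomial.gradedAlgebra

lemma homogeneousComponent_mul_of_isHomogeneous {f : MvPolynomial σ R} {e : ℕ}
    (hf : f.IsHomogeneous e) (c : MvPolynomial σ R) (d : ℕ) :
    homogeneousComponent d (c * f) = if e ≤ d then homogeneousComponent (d - e) c * f else 0 := by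
  have h (φ : MvPolynomial σ R) (i : ℕ) :
      (DirectSum.decompose (homogeneousSubmodule σ R) φ i : MvPolynomial σ R) =
        homogeneousComponent i φ := decomposition.decompose'_apply φ i
  have := DirectSum.coe_decompose_mul_of_right_mem (homogeneousSubmodule σ R) (a := c) d
    ((mem_homogeneousSubmodule e f).2 hf)
  rwa [h, h] at this

lemma homogeneousComponent_mem_span {T : Set (MvPolynomial σ R)}
    (hT : ∀ f ∈ T, ∃ e, f.IsHomogeneous e) {f : MvPolynomial σ R} (hf : f ∈ Ideal.span T) (d : ℕ) :
    homogeneousComponent d f ∈ Ideal.span T :=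
  homogeneousComponent_mem_of_mem (Ideal.homogeneous_span _ T fun f hf => hT f hf) hf d

end HomogeneousComponent

/-! ### Hilbert series -/

section Hilbert

variable {n : ℕ} {K : Type*} [Field K]

instance (I : Ideal (MvPolynomial (Fin n) K)) (d : ℕ) :
    FiniteDimensional K (quotientPiece I d) := by
  have : FiniteDimensional K (homogeneousSubmodule (Fin n) K d) :=
    Module.Finite.iff_fg.2 (homogeneousSubmodule_fg _ _ d)
  unfold quotientPiece
  infer_instance

/-- The dimensions of the graded pieces when a homogeneous nonzerodivisor is factored out. -/
lemma finrank_quotientPiece_sup {T : Set (MvPolynomial (Fin n) K)}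
    (hT : ∀ f ∈ T, ∃ e, f.IsHomogeneous e) {f : MvPolynomial (Fin n) K} {e : ℕ}
    (hf : f.IsHomogeneous e) (hreg : ∀ x, f * x ∈ Ideal.span T → x ∈ Ideal.span T) (d : ℕ) :
    Module.finrank K (quotientPiece (Ideal.span (insert f T)) d) +
      (if e ≤ d then Module.finrank K (quotientPiece (Ideal.span T) (d - e)) else 0) =
        Module.finrank K (quotientPiece (Ideal.span T) d) := by
  set J := Ideal.span T with hJ
  set J' := Ideal.span (insert f T) with hJ'
  have hle : J ≤ J' := Ideal.span_mono (Set.subset_insert f T)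
  let π : (MvPolynomial (Fin n) K ⧸ J) →ₗ[K] (MvPolynomial (Fin n) K ⧸ J') :=
    (Ideal.Quotient.factorₐ K hle).toLinearMap
  have hπ (x) : π (Ideal.Quotient.mk J x) = Ideal.Quotient.mk J' x := rfl
  let μ : (MvPolynomial (Fin n) K ⧸ J) →ₗ[K] (MvPolynomial (Fin n) K ⧸ J) :=
    LinearMap.mulLeft K (Ideal.Quotient.mk J f)
  have hμ : Function.Injective μ := by
    rw [injective_iff_map_eq_zero]
    intro y hy
    obtain ⟨x, rfl⟩ := Ideal.Quotient.mk_surjective y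
    rw [LinearMap.mulLeft_apply, ← map_mul, Ideal.Quotient.eq_zero_iff_mem] at hy
    exact Ideal.Quotient.eq_zero_iff_mem.2 (hreg x hy)
  have hrange : LinearMap.range (π.domRestrict (quotientPiece J d)) = quotientPiece J' d := by
    rw [LinearMap.range_domRestrict]
    ext y
    constructor
    · rintro ⟨_, ⟨x, hx, rfl⟩, rfl⟩
      exact ⟨x, hx, rfl⟩
    · rintro ⟨x, hx, rfl⟩
      exact ⟨_, ⟨x, hx, rfl⟩, rfl⟩
  -- The kernel in degree `d` is the image of the degree `d - e` piece under the injective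
  -- multiplication by `f`, and it is zero for `d < e`.
  have hker : Module.finrank K (LinearMap.ker (π.domRestrict (quotientPiece J d))) =
      if e ≤ d then Module.finrank K (quotientPiece J (d - e)) else 0 := by
    rw [(Submodule.equivMapOfInjective _ (quotientPiece J d).injective_subtype _).finrank_eq]
    have hmem (y) : y ∈ (LinearMap.ker (π.domRestrict (quotientPiece J d))).map
        (quotientPiece J d).subtype ↔ y ∈ quotientPiece J d ∧ π y = 0 := by
      simp [and_comm]
    -- The degree `d` component of `x = c * f + τ` shows that `c` may be replaced by a homogeneous
    -- component, as the components of `τ` stay in `J`.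
    have hform : ∀ x : MvPolynomial (Fin n) K, x.IsHomogeneous d → x ∈ J' → ∃ c,
        Ideal.Quotient.mk J x =
          Ideal.Quotient.mk J (if e ≤ d then homogeneousComponent (d - e) c * f else 0) := by
      intro x hx hxJ
      rw [hJ', Set.insert_eq, Ideal.span_union, Ideal.mem_span_singleton_sup] at hxJ
      obtain ⟨c, τ, hτ, rfl⟩ := hxJ
      refine ⟨c, Ideal.Quotient.eq.2 ?_⟩
      have h1 := homogeneousComponent_eq_self hx
      rw [map_add, homogeneousComponent_mul_of_isHomogeneous hf] at h1
      rw [← h1, add_sub_cancel_left]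
      exact homogeneousComponent_mem_span hT hτ d
    split_ifs with hed
    · rw [(Submodule.equivMapOfInjective μ hμ (quotientPiece J (d - e))).finrank_eq]
      refine congrArg (fun N : Submodule K _ => Module.finrank K N) (Submodule.ext fun y => ?_)
      rw [hmem]
      constructor
      · rintro ⟨⟨x, hx, rfl⟩, hy⟩
        obtain ⟨c, hc⟩ := hform x hx (Ideal.Quotient.eq_zero_iff_mem.1 hy)
        rw [if_pos hed] at hc
        refine ⟨_, ⟨homogeneousComponent (d - e) c, homogeneousComponent_isHomogeneous _ _, rfl⟩, ?_⟩
        exact ((mul_comm _ _).trans (map_mul (Ideal.Quotient.mk J) _ _).symm).trans hc.symm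
      · rintro ⟨_, ⟨x, hx, rfl⟩, rfl⟩
        refine ⟨⟨f * x, ?_, rfl⟩, ?_⟩
        · have := hf.mul hx
          rwa [Nat.add_sub_cancel' hed] at this
        · exact Ideal.Quotient.eq_zero_iff_mem.2
            (Ideal.mul_mem_right _ _ (Ideal.subset_span (Set.mem_insert _ _)))
    · refine (congrArg (fun N : Submodule K _ => Module.finrank K N)
        ((Submodule.eq_bot_iff _).2 ?_)).trans (finrank_bot K _)
      intro y hy
      obtain ⟨⟨x, hx, rfl⟩, hy⟩ := (hmem y).1 hy
      obtain ⟨c, hc⟩ := hform x hx (Ideal.Quotient.eq_zero_iff_mem.1 hy)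
      rw [if_neg hed, map_zero] at hc
      exact hc
  rw [← hker, ← hrange, LinearMap.finrank_range_add_finrank_ker]

theorem hilbertSeries_span_insert {T : Set (MvPolynomial (Fin n) K)}
    (hT : ∀ f ∈ T, ∃ e, f.IsHomogeneous e) {f : MvPolynomial (Fin n) K} {e : ℕ}
    (hf : f.IsHomogeneous e) (hreg : ∀ x, f * x ∈ Ideal.span T → x ∈ Ideal.span T) :
    hilbertSeries (Ideal.span (insert f T)) =
      (1 - PowerSeries.X ^ e) * hilbertSeries (Ideal.span T) := by
  ext d
  rw [sub_mul, one_mul, map_sub, PowerSeries.coeff_X_pow_mul', eq_sub_iff_add_eq]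
  simp only [hilbertSeries, PowerSeries.coeff_mk]
  rw [← finrank_quotientPiece_sup hT hf hreg d]
  split_ifs <;> push_cast <;> rfl

lemma isHomogeneous_fibreProd (ρ : Fin n → Fin n) (r : Fin n) :
    (fibreProd ρ K r).IsHomogeneous (Finset.univ.filter (ρ · = r)).card := by
  have := IsHomogeneous.prod (Finset.univ.filter (ρ · = r))
    (fun j => (X j : MvPolynomial (Fin n) K))
    (fun _ => 1) fun j _ => isHomogeneous_X K j
  rwa [Finset.sum_const, smul_eq_mul, mul_one] at this

lemma fibreProd_regular {ρ : Fin n → Fin n} (hρ : ∀ j, ρ (ρ j) = ρ j) {s : Finset (Fin n)}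
    (hs : ∀ r ∈ s, ρ r = r) {a : Fin n} (ha : ρ a = a) (has : a ∉ s) (x : MvPolynomial (Fin n) K)
    (hx : fibreProd ρ K a * x ∈ Ideal.span (fibreProd ρ K '' s)) :
    x ∈ Ideal.span (fibreProd ρ K '' s) := by
  have hX : ∀ _ : Fin n, (Polynomial.X : Polynomial K).Monic := fun _ => Polynomial.monic_X
  have h1 (r : Fin n) (hr : ρ r = r) :
      systemOf ρ (fun _ => (Polynomial.X : Polynomial K)) r = fibreProd ρ K r := if_pos hr
  have h2 := Set.image_congr fun r (hr : r ∈ (s : Set (Fin n))) => h1 r (hs r hr)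
  rw [← h2] at hx ⊢
  rw [← h1 a ha] at hx
  exact mem_span_of_systemOf_mul_mem hρ hX has hx

lemma hilbertSeries_span_fibreProd {ρ : Fin n → Fin n} (hρ : ∀ j, ρ (ρ j) = ρ j)
    (s : Finset (Fin n)) (hs : ∀ r ∈ s, ρ r = r) :
    hilbertSeries (Ideal.span (fibreProd ρ K '' s)) =
      (∏ r ∈ s, (1 - PowerSeries.X ^ (Finset.univ.filter (ρ · = r)).card)) *
        hilbertSeries (⊥ : Ideal (MvPolynomial (Fin n) K)) := by
  induction s using Finset.induction_on with
  | empty => simp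
  | insert a s ha ih =>
    have hs' : ∀ r ∈ s, ρ r = r := fun r hr => hs r (Finset.mem_insert_of_mem hr)
    rw [Finset.coe_insert, Set.image_insert_eq, hilbertSeries_span_insert (e := _) ?_
      (isHomogeneous_fibreProd ρ a)
      (fibreProd_regular hρ hs' (hs a (Finset.mem_insert_self _ _)) ha),
      ih hs', Finset.prod_insert ha, mul_assoc]
    rintro _ ⟨r, -, rfl⟩
    exact ⟨_, isHomogeneous_fibreProd ρ r⟩

lemma mem_gradedMaximalIdeal {f : MvPolynomial (Fin n) K} :
    f ∈ gradedMaximalIdeal n K ↔ constantCoeff f = 0 := by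
  rw [gradedMaximalIdeal, ← Set.image_univ, mem_ideal_span_X_image, constantCoeff_eq]
  constructor
  · intro h
    by_contra h0
    obtain ⟨i, -, hi⟩ := h 0 (mem_support_iff.2 h0)
    exact hi rfl
  · intro h m hm
    obtain ⟨i, hi⟩ := Finsupp.ne_iff.1 (show m ≠ 0 by rintro rfl; exact mem_support_iff.1 hm h)
    exact ⟨i, Set.mem_univ _, hi⟩

lemma hilbertSeries_gradedMaximalIdeal : hilbertSeries (gradedMaximalIdeal n K) = 1 := by
  ext d
  rw [hilbertSeries, PowerSeries.coeff_mk, PowerSeries.coeff_one]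
  split_ifs with hd
  · subst hd
    have : quotientPiece (gradedMaximalIdeal n K) 0 =
        K ∙ (1 : MvPolynomial (Fin n) K ⧸ gradedMaximalIdeal n K) := by
      rw [quotientPiece, homogeneousSubmodule_zero, Submodule.one_eq_span, Submodule.map_span,
        Set.image_singleton]
      rfl
    rw [this, finrank_span_singleton, Nat.cast_one]
    intro h
    rw [← map_one (Ideal.Quotient.mk (gradedMaximalIdeal n K)), Ideal.Quotient.eq_zero_iff_mem] at h
    simp [mem_gradedMaximalIdeal] at h
  · have : quotientPiece (gradedMaximalIdeal n K) d = ⊥ := by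
      refine (Submodule.eq_bot_iff _).2 ?_
      rintro _ ⟨x, hx, rfl⟩
      refine Ideal.Quotient.eq_zero_iff_mem.2 (mem_gradedMaximalIdeal.2 ?_)
      exact IsHomogeneous.coeff_eq_zero hx (by simpa using Ne.symm hd)
    rw [this, finrank_bot, Nat.cast_zero]

/-- For `ρ = id` the fibre products are the variables and the quotient is `K`, so the series of `S`
follows from the multiplicativity already proved, without counting monomials. -/
theorem hilbertSeries_bot :
    (1 - PowerSeries.X) ^ n * hilbertSeries (⊥ : Ideal (MvPolynomial (Fin n) K)) = 1 := by
  have h := hilbertSeries_span_fibreProd (K := K) (n := n) (ρ := id) (fun _ => rfl) Finset.univ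
    fun _ _ => rfl
  have h1 : Ideal.span (fibreProd (id : Fin n → Fin n) K '' ↑(Finset.univ : Finset (Fin n))) =
      gradedMaximalIdeal n K := by
    rw [gradedMaximalIdeal, Finset.coe_univ, Set.image_univ]
    congr 2
    ext1 j
    simp [fibreProd, Finset.filter_eq']
  rw [h1, hilbertSeries_gradedMaximalIdeal] at h
  refine Eq.trans (congrArg (· * _) ?_) h.symm
  simp [Finset.filter_eq']

end Hilbert

end PascalIdeal

namespace PascalIdeal

open MvPolynomial

/-! ### Uniqueness of graded Betti numbers -/

section GradedMap

variable {σ : Type*} {K : Type*} [Field K]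
variable {ι κ τ : Type*} [DecidableEq ι]

local notation "S" => MvPolynomial σ K

/-- A linear map of free modules is graded of degree `0` if its matrix entries are homogeneous of
the right degrees. -/
def IsGradedMap (p : ι → ℕ) (q : κ → ℕ) (φ : (ι → S) →ₗ[S] (κ → S)) : Prop :=
  ∀ b a, φ (Pi.single b 1) a ≠ 0 →
    ∃ m : ℕ, m + q a = p b ∧ (φ (Pi.single b 1) a).IsHomogeneous m

lemma IsGradedMap.isHomogeneous {p : ι → ℕ} {q : κ → ℕ} {φ : (ι → S) →ₗ[S] (κ → S)}
    (h : IsGradedMap p q φ) {b : ι} {a : κ} {m : ℕ} (hm : m + q a = p b) :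
    (φ (Pi.single b 1) a).IsHomogeneous m := by
  by_cases h0 : φ (Pi.single b 1) a = 0
  · rw [h0]
    exact isHomogeneous_zero _ _ _
  · obtain ⟨m', hm', hh⟩ := h b a h0
    rwa [show m = m' by omega]

lemma apply_eq_sum [Fintype ι] (φ : (ι → S) →ₗ[S] (κ → S)) (v : ι → S) (a : κ) :
    φ v a = ∑ b, v b * φ (Pi.single b 1) a := by
  conv_lhs => rw [← Finset.univ_sum_single v]
  rw [map_sum, Finset.sum_apply]
  refine Finset.sum_congr rfl fun b _ => ?_
  rw [← smul_eq_mul, ← Pi.smul_apply, ← map_smul, ← Pi.single_smul, smul_eq_mul, mul_one]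

lemma IsGradedMap.comp [Fintype κ] [DecidableEq κ] {p : ι → ℕ} {q : κ → ℕ} {r : τ → ℕ}
    {φ : (ι → S) →ₗ[S] (κ → S)}
    {ψ : (κ → S) →ₗ[S] (τ → S)} (hψ : IsGradedMap q r ψ) (hφ : IsGradedMap p q φ) :
    IsGradedMap p r (ψ ∘ₗ φ) := by
  intro b a h
  rw [LinearMap.comp_apply, apply_eq_sum] at h ⊢
  have hex : r a ≤ p b := by
    obtain ⟨c, -, hc⟩ := Finset.exists_ne_zero_of_sum_ne_zero h
    obtain ⟨m, hm, -⟩ := hφ b c (left_ne_zero_of_mul hc)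
    obtain ⟨m', hm', -⟩ := hψ c a (right_ne_zero_of_mul hc)
    omega
  refine ⟨p b - r a, by omega, IsHomogeneous.sum _ _ _ fun c _ => ?_⟩
  by_cases hc : φ (Pi.single b 1) c * ψ (Pi.single c 1) a = 0
  · rw [hc]
    exact isHomogeneous_zero _ _ _
  · obtain ⟨m, hm, h1⟩ := hφ b c (left_ne_zero_of_mul hc)
    obtain ⟨m', hm', h2⟩ := hψ c a (right_ne_zero_of_mul hc)
    rw [show p b - r a = m + m' by omega]
    exact h1.mul h2

lemma exists_comp_eq [Fintype ι] (φ : (ι → S) →ₗ[S] (κ → S)) (ψ : (τ → S) →ₗ[S] (κ → S))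
    (h : ∀ x, ∃ y, ψ y = φ x) : ∃ f : (ι → S) →ₗ[S] (τ → S), ∀ x, ψ (f x) = φ x := by
  choose w hw using fun b => h (Pi.single b 1)
  refine ⟨(Pi.basisFun S ι).constr S w, fun x => ?_⟩
  have : ψ ∘ₗ (Pi.basisFun S ι).constr S w = φ := by
    refine (Pi.basisFun S ι).ext fun b => ?_
    rw [LinearMap.comp_apply, Module.Basis.constr_basis, hw, Pi.basisFun_apply]
  exact DFunLike.congr_fun this x

/-- Any lift of a basis vector can be replaced by its components of the required degrees: applying
`ψ` and taking the component of the right degree still gives `φ`, whose entries are homogeneous. -/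
theorem IsGradedMap.exists_comp_eq [Fintype ι] [Fintype τ] [DecidableEq τ]
    {p : ι → ℕ} {q : κ → ℕ} {r : τ → ℕ}
    {φ : (ι → S) →ₗ[S] (κ → S)} {ψ : (τ → S) →ₗ[S] (κ → S)} (hφ : IsGradedMap p q φ)
    (hψ : IsGradedMap r q ψ) (h : ∀ x, ∃ y, ψ y = φ x) :
    ∃ f : (ι → S) →ₗ[S] (τ → S), IsGradedMap p r f ∧ ∀ x, ψ (f x) = φ x := by
  choose v hv using fun b => h (Pi.single b 1)
  let w : ι → τ → S := fun b c =>
    if r c ≤ p b then homogeneousComponent (p b - r c) (v b c) else 0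
  have hw (b) : ψ (w b) = φ (Pi.single b 1) := by
    ext1 a
    rw [apply_eq_sum]
    by_cases hab : q a ≤ p b
    · rw [← homogeneousComponent_eq_self
        (hφ.isHomogeneous (b := b) (a := a) (m := p b - q a) (by omega)), ← hv, apply_eq_sum,
        map_sum]
      refine Finset.sum_congr rfl fun c _ => ?_
      by_cases hc : ψ (Pi.single c 1) a = 0
      · rw [hc, mul_zero, mul_zero, map_zero]
      · obtain ⟨m, hm, hh⟩ := hψ c a hc
        rw [homogeneousComponent_mul_of_isHomogeneous hh]
        by_cases hcb : r c ≤ p b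
        · rw [if_pos (by omega), show p b - q a - m = p b - r c by omega]
          simp only [w, if_pos hcb]
        · rw [if_neg (by omega)]
          simp only [w, if_neg hcb, zero_mul]
    · have h0 : φ (Pi.single b 1) a = 0 := by
        by_contra h0
        obtain ⟨m, hm, -⟩ := hφ b a h0
        omega
      rw [h0]
      refine Finset.sum_eq_zero fun c _ => ?_
      by_contra hc
      obtain ⟨m, hm, -⟩ := hψ c a (right_ne_zero_of_mul hc)
      refine left_ne_zero_of_mul hc (if_neg ?_)
      omega
  have hf (b) : (Pi.basisFun S ι).constr S w (Pi.single b 1) = w b := by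
    rw [← Pi.basisFun_apply, Module.Basis.constr_basis]
  refine ⟨(Pi.basisFun S ι).constr S w, fun b c hbc => ?_, fun x => ?_⟩
  · rw [hf] at hbc ⊢
    simp only [w] at hbc ⊢
    split_ifs at hbc ⊢ with hcb
    · exact ⟨p b - r c, by omega, homogeneousComponent_isHomogeneous _ _⟩
    · exact absurd rfl hbc
  · have : ψ ∘ₗ (Pi.basisFun S ι).constr S w = φ := by
      refine (Pi.basisFun S ι).ext fun b => ?_
      rw [LinearMap.comp_apply, Module.Basis.constr_basis, hw, Pi.basisFun_apply]
    exact DFunLike.congr_fun this x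

end GradedMap

/-! ### Comparison of minimal resolutions of a cyclic module -/

section Resolution

variable {n : ℕ} {K : Type*} [Field K]

local notation "S" => MvPolynomial (Fin n) K

/-- A minimal graded free resolution of the cyclic module `S / I`. -/
structure CyclicResolution (I : Ideal (MvPolynomial (Fin n) K)) where
  /-- the index type of the generators in homological degree `i` -/
  ι : ℕ → Type
  [fintype : ∀ i, Fintype (ι i)]
  [decEq : ∀ i, DecidableEq (ι i)]
  /-- the degrees of the generators -/
  deg : (i : ℕ) → ι i → ℕ
  /-- the differential -/
  d : (i : ℕ) → (ι (i + 1) → MvPolynomial (Fin n) K) →ₗ[MvPolynomial (Fin n) K]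
    (ι i → MvPolynomial (Fin n) K)
  /-- the generator in homological degree `0` -/
  [unique : Unique (ι 0)]
  deg_zero : ∀ a, deg 0 a = 0
  graded : ∀ i, IsGradedMap (deg (i + 1)) (deg i) (d i)
  mem_iff : ∀ f, f ∈ I ↔ ∃ v, d 0 v = fun _ => f
  exact : ∀ i, Function.Exact (d (i + 1)) (d i)
  minimal : ∀ i x a, d i x a ∈ gradedMaximalIdeal n K

namespace CyclicResolution

attribute [instance] CyclicResolution.fintype CyclicResolution.decEq CyclicResolution.unique

variable {I : Ideal (MvPolynomial (Fin n) K)}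

lemma apply_mem_ideal {ι κ : Type*} [Fintype ι] [DecidableEq ι] (φ : (ι → S) →ₗ[S] (κ → S))
    {J : Ideal S} {v : ι → S} (hv : ∀ b, v b ∈ J) (a : κ) : φ v a ∈ J := by
  rw [apply_eq_sum]
  exact sum_mem fun b _ => Ideal.mul_mem_right _ _ (hv b)

/-- Two minimal resolutions are compared by graded maps that are inverse to each other modulo the
maximal ideal. -/
theorem exists_comparison (A B : CyclicResolution I) (i : ℕ) :
    ∃ (f : (A.ι i → S) →ₗ[S] (B.ι i → S)) (g : (B.ι i → S) →ₗ[S] (A.ι i → S))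
      (s : (A.ι i → S) →ₗ[S] (A.ι (i + 1) → S)),
      IsGradedMap (A.deg i) (B.deg i) f ∧ IsGradedMap (B.deg i) (A.deg i) g ∧
      (∀ x, ∃ y, B.d i y = f (A.d i x)) ∧ (∀ x, ∃ y, A.d i y = g (B.d i x)) ∧
      (∀ x, A.d i (s (A.d i x)) = g (f (A.d i x)) - A.d i x) ∧
      ∀ x a, (g (f x) - x) a ∈ gradedMaximalIdeal n K := by
  induction i with
  | zero =>
    have key (A B : CyclicResolution I) : ∃ f : (A.ι 0 → S) →ₗ[S] (B.ι 0 → S),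
        (∀ v a, f v a = v default) ∧ IsGradedMap (A.deg 0) (B.deg 0) f ∧
        ∀ x, ∃ y, B.d 0 y = f (A.d 0 x) := by
      let f : (A.ι 0 → S) →ₗ[S] (B.ι 0 → S) := LinearMap.funLeft S S fun _ => default
      refine ⟨f, fun _ _ => rfl, fun b a _ => ⟨0, ?_, ?_⟩, fun x => ?_⟩
      · rw [A.deg_zero, B.deg_zero]
      · have : f (Pi.single b 1) a = 1 := by
          rw [LinearMap.funLeft_apply, Subsingleton.elim b default, Pi.single_eq_same]
        rw [this]
        exact isHomogeneous_one _ _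
      · have : A.d 0 x default ∈ I :=
          (A.mem_iff _).2 ⟨x, funext fun a => by rw [Subsingleton.elim a default]⟩
        obtain ⟨y, hy⟩ := (B.mem_iff _).1 this
        exact ⟨y, hy⟩
    obtain ⟨f, hf, hf1, hf2⟩ := key A B
    obtain ⟨g, hg, hg1, hg2⟩ := key B A
    have hgf (x) : g (f x) - x = 0 := by
      ext1 a
      rw [Pi.sub_apply, hg, hf, Subsingleton.elim a default, sub_self, Pi.zero_apply]
    refine ⟨f, g, 0, hf1, hg1, hf2, hg2, fun x => ?_, fun x a => ?_⟩
    · rw [LinearMap.zero_apply, map_zero, hgf]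
    · rw [hgf]
      exact zero_mem _
  | succ i ih =>
    obtain ⟨f, g, s, hf, hg, hfd, hgd, hs, -⟩ := ih
    obtain ⟨f', hf', hf'd⟩ := (hf.comp (A.graded i)).exists_comp_eq (B.graded i) hfd
    obtain ⟨g', hg', hg'd⟩ := (hg.comp (B.graded i)).exists_comp_eq (A.graded i) hgd
    simp only [LinearMap.comp_apply] at hf'd hg'd
    -- The homotopy identity is carried only on the image of `A.d i`. This suffices to make `g' f' -
    -- id - s ∘ d` take values in the kernel of `A.d i`, hence to lift it to `s'`.
    have hs' (x) : ∃ y, A.d (i + 1) y = (g' ∘ₗ f' - LinearMap.id - s ∘ₗ A.d i :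
        (A.ι (i + 1) → S) →ₗ[S] (A.ι (i + 1) → S)) x := by
      refine (A.exact i _).1 ?_
      simp only [LinearMap.sub_apply, LinearMap.comp_apply, LinearMap.id_apply, map_sub, hg'd, hf'd,
        hs, sub_self]
    obtain ⟨s', hs'⟩ := PascalIdeal.exists_comp_eq _ _ hs'
    simp only [LinearMap.sub_apply, LinearMap.comp_apply, LinearMap.id_apply] at hs'
    refine ⟨f', g', s', hf', hg', fun x => (B.exact i _).1 ?_, fun x => (A.exact i _).1 ?_,
      fun x => ?_, fun x a => ?_⟩
    · rw [hf'd, (A.exact i).apply_apply_eq_zero, map_zero]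
    · rw [hg'd, (B.exact i).apply_apply_eq_zero, map_zero]
    · rw [hs', (A.exact i).apply_apply_eq_zero, map_zero, sub_zero]
    · have : g' (f' x) - x = A.d (i + 1) (s' x) + s (A.d i x) := by rw [hs']; abel
      rw [this, Pi.add_apply]
      exact add_mem (A.minimal _ _ _) (apply_mem_ideal s (A.minimal i x) a)

/-- The number of generators of degree `j` in homological degree `i`. -/
def count (A : CyclicResolution I) (i j : ℕ) : ℕ :=
  (Finset.univ.filter fun a : A.ι i => A.deg i a = j).card

/-- Modulo the maximal ideal `g ∘ f` is the identity. A matrix entry has nonzero constant term only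
between generators of equal degree, so the constant terms in degree `j` form blocks with `F * G =
1`, whence the inequality of sizes. -/
lemma count_le_count (A B : CyclicResolution I) (i j : ℕ) : A.count i j ≤ B.count i j := by
  obtain ⟨f, g, -, hf, hg, -, -, -, hgf⟩ := exists_comparison A B i
  let F : Matrix {b // A.deg i b = j} {c // B.deg i c = j} K :=
    Matrix.of fun b c => constantCoeff (f (Pi.single b.1 1) c.1)
  let G : Matrix {c // B.deg i c = j} {b // A.deg i b = j} K :=
    Matrix.of fun c b => constantCoeff (g (Pi.single c.1 1) b.1)
  have hFG : F * G = 1 := by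
    ext b a
    have h1 := mem_gradedMaximalIdeal.1 (hgf (Pi.single b.1 1) a.1)
    rw [Pi.sub_apply, map_sub, sub_eq_zero, apply_eq_sum, map_sum] at h1
    have h2 : ∑ c : {c // B.deg i c = j}, F b c * G c a =
        ∑ c, constantCoeff (f (Pi.single b.1 1) c * g (Pi.single c 1) a.1) := by
      rw [← Finset.sum_filter_of_ne (p := fun c => B.deg i c = j),
        Finset.sum_subtype (F := inferInstance) _ (p := fun c => B.deg i c = j) (by simp)]
      · simp only [F, G, Matrix.of_apply, map_mul]
      · intro c _ hc
        rw [map_mul] at hc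
        have hc := left_ne_zero_of_mul hc
        obtain ⟨m, hm, hh⟩ := hf b.1 c fun h => hc (by rw [h, map_zero])
        have : m = 0 := by
          by_contra h0
          exact hc (hh.coeff_eq_zero (by simpa using Ne.symm h0))
        rw [← b.2, ← hm, this, zero_add]
    rw [Matrix.mul_apply, h2, h1, Matrix.one_apply, Pi.single_apply]
    by_cases hab : a = b
    · simp [hab]
    · rw [if_neg (fun h => hab (Subtype.ext h)), if_neg (fun h => hab h.symm), map_zero]
  have h3 : Function.Injective (Matrix.vecMulLinear F) := by
    refine Function.LeftInverse.injective (g := fun v => Matrix.vecMul v G) fun v => ?_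
    change Matrix.vecMul (Matrix.vecMul v F) G = v
    rw [Matrix.vecMul_vecMul, hFG, Matrix.vecMul_one]
  have h4 := LinearMap.finrank_le_finrank_of_injective h3
  rw [Module.finrank_fintype_fun_eq_card, Module.finrank_fintype_fun_eq_card,
    Fintype.card_subtype, Fintype.card_subtype] at h4
  exact h4

theorem count_eq_count (A B : CyclicResolution I) (i j : ℕ) : A.count i j = B.count i j :=
  (count_le_count A B i j).antisymm (count_le_count B A i j)

end CyclicResolution

end Resolution

end PascalIdeal

namespace PascalIdeal

open MvPolynomial

/-! ### Koszul resolutions by iterated mapping cones -/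

section Koszul

variable {n : ℕ} {K : Type*} [Field K]

local notation "S" => MvPolynomial (Fin n) K

namespace CyclicResolution

variable {I : Ideal (MvPolynomial (Fin n) K)}

lemma apply_eq_const (A : CyclicResolution I) (v : A.ι 0 → S) : v = fun _ => v default :=
  funext fun a => by rw [Subsingleton.elim a default]

lemma le_gradedMaximalIdeal (A : CyclicResolution I) : I ≤ gradedMaximalIdeal n K := by
  intro f hf
  obtain ⟨v, hv⟩ := (A.mem_iff f).1 hf
  have := A.minimal 0 v default
  rwa [hv] at this

/-- A minimal graded free resolution of `I` as a resolution of `S / I`. -/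
noncomputable def ofMinimal (hI : I ≤ gradedMaximalIdeal n K)
    (F : MinimalGradedFreeResolution I) : CyclicResolution I where
  ι
    | 0 => Unit
    | i + 1 => Fin (F.rank i)
  fintype
    | 0 => inferInstanceAs (Fintype Unit)
    | i + 1 => inferInstanceAs (Fintype (Fin (F.rank i)))
  decEq
    | 0 => inferInstanceAs (DecidableEq Unit)
    | i + 1 => inferInstanceAs (DecidableEq (Fin (F.rank i)))
  deg
    | 0 => fun _ => 0
    | i + 1 => F.deg i
  d
    | 0 => LinearMap.pi fun _ => F.aug
    | i + 1 => F.d i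
  unique := inferInstanceAs (Unique Unit)
  deg_zero _ := rfl
  graded
    | 0 => fun b _ _ => ⟨F.deg 0 b, rfl, F.aug_homogeneous b⟩
    | i + 1 => F.d_homogeneous i
  mem_iff f := by
    conv_lhs => rw [← F.range_aug]
    exact exists_congr fun v => ⟨fun h => funext fun _ => h, fun h => congrFun h ()⟩
  exact
    | 0 => fun x => (show _ ↔ F.aug x = 0 from
        ⟨fun h => congrFun h (), fun h => funext fun _ => h⟩).trans (F.exact_zero x)
    | i + 1 => F.exact_succ i
  minimal
    | 0 => fun x _ => hI (F.range_aug.le ⟨x, rfl⟩)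
    | i + 1 => F.minimal i

/-- The resolution of `I` in a resolution of `S / I`. -/
noncomputable def toMinimal (A : CyclicResolution I) : MinimalGradedFreeResolution I :=
  let e (i : ℕ) := Fintype.equivFin (A.ι (i + 1))
  have he (i : ℕ) (b : Fin (Fintype.card (A.ι (i + 1)))) :
      LinearMap.funLeft S S (e i) (Pi.single b 1) = Pi.single ((e i).symm b) 1 := by
    ext1 a
    simp only [LinearMap.funLeft_apply, Pi.single_apply, Equiv.eq_symm_apply]
  have hsurj (i : ℕ) : Function.Surjective (LinearMap.funLeft S S (e i)) :=
    LinearMap.funLeft_surjective_of_injective _ _ _ (e i).injective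
  have hrange (i : ℕ) (x) : LinearMap.funLeft S S (e i) x ∈ Set.range (A.d (i + 1)) ↔
      x ∈ Set.range (LinearMap.funLeft S S (e i).symm ∘ₗ A.d (i + 1) ∘ₗ
        LinearMap.funLeft S S (e (i + 1))) := by
    rw [Set.mem_range, Set.mem_range, (hsurj (i + 1)).exists]
    refine exists_congr fun z => ⟨fun h => funext fun a => ?_, fun h => funext fun a => ?_⟩
    · rw [LinearMap.comp_apply, LinearMap.comp_apply, h, LinearMap.funLeft_apply,
        LinearMap.funLeft_apply, Equiv.apply_symm_apply]
    · rw [← h, LinearMap.comp_apply, LinearMap.comp_apply, LinearMap.funLeft_apply,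
        LinearMap.funLeft_apply, Equiv.symm_apply_apply]
  { rank := fun i => Fintype.card (A.ι (i + 1))
    deg := fun i a => A.deg (i + 1) ((e i).symm a)
    aug := LinearMap.proj default ∘ₗ A.d 0 ∘ₗ LinearMap.funLeft S S (e 0)
    d := fun i => LinearMap.funLeft S S (e i).symm ∘ₗ A.d (i + 1) ∘ₗ LinearMap.funLeft S S (e (i + 1))
    aug_homogeneous := fun b => by
      simp only [LinearMap.comp_apply, he, LinearMap.proj_apply]
      exact (A.graded 0).isHomogeneous (by rw [A.deg_zero, add_zero])
    d_homogeneous := fun i b a h => by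
      simp only [LinearMap.comp_apply, he, LinearMap.funLeft_apply] at h ⊢
      exact A.graded (i + 1) _ _ h
    range_aug := by
      ext f
      rw [A.mem_iff, LinearMap.mem_range, (hsurj 0).exists]
      exact exists_congr fun v => ⟨fun h => (A.apply_eq_const _).trans (by rw [← h]; rfl),
        fun h => congrFun h default⟩
    exact_zero := fun x => by
      have h1 : A.d 0 (LinearMap.funLeft S S (e 0) x) default = 0 ↔
          A.d 0 (LinearMap.funLeft S S (e 0) x) = 0 :=
        ⟨fun h => (A.apply_eq_const _).trans (by rw [h]; rfl), fun h => congrFun h default⟩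
      exact h1.trans ((A.exact 0 _).trans (hrange 0 x))
    exact_succ := fun i x => by
      refine Iff.trans ?_ ((A.exact (i + 1) _).trans (hrange (i + 1) x))
      rw [LinearMap.comp_apply, LinearMap.comp_apply]
      refine ⟨fun h => funext fun a => ?_, fun h => by rw [h, map_zero]⟩
      simpa [LinearMap.funLeft_apply] using congrFun h (e i a)
    minimal := fun i x a => A.minimal _ _ _ }

/-- The chosen resolution of `I` extends to one of `S / I`, so any other may be used for counting.
Passing from `I` to `S / I` raises the homological degree by one. -/
theorem gradedBetti_eq_count (A : CyclicResolution I) (i j : ℕ) :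
    gradedBetti I i j = A.count (i + 1) j := by
  have h : Nonempty (MinimalGradedFreeResolution I) := ⟨A.toMinimal⟩
  rw [gradedBetti, dif_pos h, count_eq_count A (ofMinimal A.le_gradedMaximalIdeal h.some)]
  rfl

/-- The resolution of `S` by itself. -/
noncomputable def self (n : ℕ) (K : Type*) [Field K] :
    CyclicResolution (⊥ : Ideal (MvPolynomial (Fin n) K)) where
  ι
    | 0 => Unit
    | _ + 1 => Empty
  fintype
    | 0 => inferInstanceAs (Fintype Unit)
    | _ + 1 => inferInstanceAs (Fintype Empty)
  decEq
    | 0 => inferInstanceAs (DecidableEq Unit)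
    | _ + 1 => inferInstanceAs (DecidableEq Empty)
  deg _ _ := 0
  d _ := 0
  unique := inferInstanceAs (Unique Unit)
  deg_zero _ := rfl
  graded _ _ _ h := absurd rfl h
  mem_iff _ := ⟨fun h => ⟨0, funext fun _ => ((Submodule.mem_bot _).1 h).symm⟩,
    fun ⟨_, h⟩ => (Submodule.mem_bot _).2 (congrFun h ()).symm⟩
  exact _ _ := ⟨fun _ => ⟨0, funext fun a => a.elim⟩, fun _ => rfl⟩
  minimal _ _ _ := zero_mem _

lemma single_inl_inl {α β : Type*} [DecidableEq α] [DecidableEq β] (b : α) :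
    LinearMap.funLeft S S (Sum.inl : α → α ⊕ β) (Pi.single (Sum.inl b) 1) = Pi.single b 1 := by
  ext1 a
  simp [LinearMap.funLeft_apply, Pi.single_apply]

lemma single_inl_inr {α β : Type*} [DecidableEq α] [DecidableEq β] (b : α) :
    LinearMap.funLeft S S (Sum.inr : β → α ⊕ β) (Pi.single (Sum.inl b) 1) = 0 := by
  ext1 a
  simp [LinearMap.funLeft_apply]

lemma single_inr_inl {α β : Type*} [DecidableEq α] [DecidableEq β] (b : β) :
    LinearMap.funLeft S S (Sum.inl : α → α ⊕ β) (Pi.single (Sum.inr b) 1) = 0 := by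
  ext1 a
  simp [LinearMap.funLeft_apply]

lemma single_inr_inr {α β : Type*} [DecidableEq α] [DecidableEq β] (b : β) :
    LinearMap.funLeft S S (Sum.inr : β → α ⊕ β) (Pi.single (Sum.inr b) 1) = Pi.single b 1 := by
  ext1 a
  simp [LinearMap.funLeft_apply, Pi.single_apply]

variable (A : CyclicResolution I) (f : MvPolynomial (Fin n) K)

/-- The index types of the mapping cone of multiplication by `f`. -/
def coneIndex : ℕ → Type
  | 0 => A.ι 0
  | i + 1 => A.ι (i + 1) ⊕ A.ι i

instance : ∀ i, Fintype (A.coneIndex i)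
  | 0 => inferInstanceAs (Fintype (A.ι 0))
  | i + 1 => inferInstanceAs (Fintype (A.ι (i + 1) ⊕ A.ι i))

instance : ∀ i, DecidableEq (A.coneIndex i)
  | 0 => inferInstanceAs (DecidableEq (A.ι 0))
  | i + 1 => inferInstanceAs (DecidableEq (A.ι (i + 1) ⊕ A.ι i))

/-- The component of the differential of the mapping cone in the resolution itself. -/
noncomputable def coneFst (i : ℕ) : (A.ι (i + 1) ⊕ A.ι i → S) →ₗ[S] (A.ι i → S) :=
  A.d i ∘ₗ LinearMap.funLeft S S Sum.inl + f • LinearMap.funLeft S S Sum.inr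

/-- The component of the differential of the mapping cone in the shifted resolution. -/
noncomputable def coneSnd (i : ℕ) : (A.ι (i + 2) ⊕ A.ι (i + 1) → S) →ₗ[S] (A.ι i → S) :=
  -(A.d i ∘ₗ LinearMap.funLeft S S Sum.inr)

/-- The differential of the mapping cone of multiplication by `f`. -/
noncomputable def coneD : (i : ℕ) → (A.coneIndex (i + 1) → S) →ₗ[S] (A.coneIndex i → S)
  | 0 => A.coneFst f 0
  | i + 1 => (LinearEquiv.sumArrowLequivProdArrow (A.ι (i + 1)) (A.ι i) S S).symm.toLinearMap ∘ₗ
      (A.coneFst f (i + 1)).prod (A.coneSnd i)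

variable {f}

/-- The mapping cone of multiplication by a nonzerodivisor modulo `I`. -/
noncomputable def cone {e : ℕ} (he : 0 < e) (hf : f.IsHomogeneous e)
    (hreg : ∀ x, f * x ∈ I → x ∈ I) : CyclicResolution (I ⊔ Ideal.span {f}) where
  ι := A.coneIndex
  deg
    | 0 => A.deg 0
    | i + 1 => Sum.elim (A.deg (i + 1)) fun a => A.deg i a + e
  d := A.coneD f
  unique := inferInstanceAs (Unique (A.ι 0))
  deg_zero := A.deg_zero
  graded := by
    have h1 (i : ℕ) : IsGradedMap (Sum.elim (A.deg (i + 1)) fun a => A.deg i a + e) (A.deg i)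
        (A.coneFst f i) := by
      rintro (b | b) a h
      · simp only [coneFst, LinearMap.add_apply, LinearMap.smul_apply, LinearMap.comp_apply,
          single_inl_inl, single_inl_inr, smul_zero, add_zero] at h ⊢
        exact A.graded i b a h
      · simp only [coneFst, LinearMap.add_apply, LinearMap.smul_apply, LinearMap.comp_apply,
          single_inr_inl, single_inr_inr, map_zero, zero_add, Pi.smul_apply, smul_eq_mul] at h ⊢
        have hab : a = b := by
          by_contra hab
          rw [Pi.single_eq_of_ne hab, mul_zero] at h
          exact h rfl
        subst hab
        rw [Pi.single_eq_same, mul_one]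
        exact ⟨e, add_comm _ _, hf⟩
    intro i
    match i with
    | 0 => exact h1 0
    | i + 1 =>
      rintro b (a | a) h
      · exact h1 (i + 1) b a h
      · change A.coneSnd i (Pi.single b 1) a ≠ 0 at h
        change ∃ m, m + (A.deg i a + e) = _ ∧ (A.coneSnd i (Pi.single b 1) a).IsHomogeneous m
        rcases b with b | b
        · simp only [coneSnd, LinearMap.neg_apply, LinearMap.comp_apply, single_inl_inr, map_zero,
            neg_zero] at h
          exact absurd rfl h
        · simp only [coneSnd, LinearMap.neg_apply, LinearMap.comp_apply, single_inr_inr,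
            Pi.neg_apply] at h ⊢
          obtain ⟨m, hm, hh⟩ := A.graded i b a (neg_ne_zero.1 h)
          exact ⟨m, by rw [← add_assoc, hm]; rfl, hh.neg⟩
  mem_iff g := by
    constructor
    · intro hg
      obtain ⟨x, hx, y, hy, rfl⟩ := Submodule.mem_sup.1 hg
      obtain ⟨a, rfl⟩ := Ideal.mem_span_singleton.1 hy
      obtain ⟨v, hv⟩ := (A.mem_iff x).1 hx
      refine ⟨(Sum.elim v fun _ => a : A.ι 1 ⊕ A.ι 0 → S), ?_⟩
      change A.d 0 v + f • (fun _ : A.ι 0 => a) = _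
      rw [hv]
      rfl
    · rintro ⟨v, hv⟩
      have h1 := congrFun hv (default : A.ι 0)
      rw [← h1]
      refine add_mem (Ideal.mem_sup_left ((A.mem_iff _).2
        ⟨LinearMap.funLeft S S (Sum.inl : A.ι 1 → A.ι 1 ⊕ A.ι 0) v, A.apply_eq_const _⟩)) ?_
      exact Ideal.mem_sup_right (Ideal.mul_mem_right _ _ (Ideal.mem_span_singleton_self f))
  exact := by
    have key (i : ℕ) (x : A.ι (i + 1) → S) (y : A.ι i → S) (hxy : A.d i x + f • y = 0)
        (hy : ∃ w, A.d i w = y) : ∃ (u : A.ι (i + 2) → S) (t : A.ι (i + 1) → S),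
          A.d (i + 1) u + f • t = x ∧ -A.d i t = y := by
      obtain ⟨w, rfl⟩ := hy
      rw [← map_smul, ← map_add] at hxy
      obtain ⟨u, hu⟩ := (A.exact i _).1 hxy
      exact ⟨u, -w, by rw [hu, smul_neg, add_neg_cancel_right], by rw [map_neg, neg_neg]⟩
    have key' (i : ℕ) (u : A.ι (i + 2) → S) (t : A.ι (i + 1) → S) :
        A.d i (A.d (i + 1) u + f • t) + f • (-A.d i t) = 0 := by
      rw [map_add, (A.exact i).apply_apply_eq_zero, map_smul, zero_add, smul_neg, add_neg_cancel]
    intro i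
    match i with
    | 0 =>
      intro v
      let x : A.ι 1 → S := LinearMap.funLeft S S (Sum.inl : A.ι 1 → A.ι 1 ⊕ A.ι 0) v
      let y : A.ι 0 → S := LinearMap.funLeft S S (Sum.inr : A.ι 0 → A.ι 1 ⊕ A.ι 0) v
      constructor
      · intro h
        have h : A.d 0 x + f • y = 0 := h
        -- In the lowest degree the shifted copy of the resolution is not exact but has homology `S
        -- / I`; injectivity of `f` on it gives `y ∈ I`. In higher degrees exactness of `A` takes
        -- this role.
        have hy : y default ∈ I := by
          refine hreg _ ((A.mem_iff _).2 ⟨-x, ?_⟩)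
          rw [map_neg, neg_eq_of_add_eq_zero_right h]
          exact A.apply_eq_const _
        obtain ⟨w, hw⟩ := (A.mem_iff _).1 hy
        obtain ⟨u, t, hu, ht⟩ := key 0 x y h ⟨w, hw.trans (A.apply_eq_const y).symm⟩
        refine ⟨(Sum.elim u t : A.ι 2 ⊕ A.ι 1 → S), funext ?_⟩
        rintro (a | a)
        · exact congrFun hu a
        · exact congrFun ht a
      · rintro ⟨z, rfl⟩
        exact key' 0 (LinearMap.funLeft S S (Sum.inl : A.ι 2 → A.ι 2 ⊕ A.ι 1) z)
          (LinearMap.funLeft S S (Sum.inr : A.ι 1 → A.ι 2 ⊕ A.ι 1) z)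
    | i + 1 =>
      intro v
      let x : A.ι (i + 2) → S :=
        LinearMap.funLeft S S (Sum.inl : A.ι (i + 2) → A.ι (i + 2) ⊕ A.ι (i + 1)) v
      let y : A.ι (i + 1) → S :=
        LinearMap.funLeft S S (Sum.inr : A.ι (i + 1) → A.ι (i + 2) ⊕ A.ι (i + 1)) v
      constructor
      · intro h
        have h1 : A.d (i + 1) x + f • y = 0 := funext fun a => congrFun h (Sum.inl a)
        have h2 : -A.d i y = 0 := funext fun a => congrFun h (Sum.inr a)
        obtain ⟨u, t, hu, ht⟩ := key (i + 1) x y h1 ((A.exact i y).1 (neg_eq_zero.1 h2))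
        refine ⟨(Sum.elim u t : A.ι (i + 3) ⊕ A.ι (i + 2) → S), funext ?_⟩
        rintro (a | a)
        · exact congrFun hu a
        · exact congrFun ht a
      · rintro ⟨z, rfl⟩
        let u := LinearMap.funLeft S S (Sum.inl : A.ι (i + 3) → A.ι (i + 3) ⊕ A.ι (i + 2)) z
        let t := LinearMap.funLeft S S (Sum.inr : A.ι (i + 2) → A.ι (i + 3) ⊕ A.ι (i + 2)) z
        funext a
        rcases a with a | a
        · exact congrFun (key' (i + 1) u t) a
        · change (-A.d i (-A.d (i + 1) t)) a = 0
          rw [map_neg, (A.exact i).apply_apply_eq_zero, neg_zero, neg_zero, Pi.zero_apply]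
  minimal := by
    have hfm : f ∈ gradedMaximalIdeal n K :=
      mem_gradedMaximalIdeal.2 (hf.coeff_eq_zero (by simpa using he.ne))
    have h1 (i : ℕ) (v : A.ι (i + 1) ⊕ A.ι i → S) (a : A.ι i) :
        A.coneFst f i v a ∈ gradedMaximalIdeal n K :=
      add_mem (A.minimal _ _ _) (Ideal.mul_mem_right _ _ hfm)
    intro i v a
    match i, a with
    | 0, a => exact h1 0 v a
    | i + 1, Sum.inl a => exact h1 (i + 1) v a
    | i + 1, Sum.inr a => exact neg_mem (A.minimal i _ a)

end CyclicResolution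

variable {ρ : Fin n → Fin n}

/-- The degrees of the generators of the Koszul resolution of products over fibres. -/
theorem exists_cyclicResolution (hρ : ∀ j, ρ (ρ j) = ρ j) (s : Finset (Fin n))
    (hs : ∀ r ∈ s, ρ r = r) :
    ∃ A : CyclicResolution (Ideal.span (fibreProd ρ K '' s)),
      (∀ i a, i ≤ s.card ∧
        A.deg i a + s.card ≤ ∑ r ∈ s, (Finset.univ.filter (ρ · = r)).card + i ∧
        (i < s.card → A.deg i a < ∑ r ∈ s, (Finset.univ.filter (ρ · = r)).card)) ∧
      ∃ a, A.deg s.card a = ∑ r ∈ s, (Finset.univ.filter (ρ · = r)).card := by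
  induction s using Finset.induction_on with
  | empty =>
    rw [Finset.coe_empty, Set.image_empty, Ideal.span_empty]
    refine ⟨CyclicResolution.self n K, fun i a => ?_, (), rfl⟩
    match i, a with
    | 0, a => exact ⟨le_rfl, le_rfl, fun h => absurd h (Nat.lt_irrefl _)⟩
    | i + 1, a => exact a.elim
  | insert r s hr ih =>
    have hs' : ∀ r ∈ s, ρ r = r := fun r hr => hs r (Finset.mem_insert_of_mem hr)
    have hrr := hs r (Finset.mem_insert_self _ _)
    obtain ⟨A, hA, a₀, ha₀⟩ := ih hs'
    have he : 0 < (Finset.univ.filter (ρ · = r)).card :=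
      Finset.card_pos.2 ⟨r, Finset.mem_filter.2 ⟨Finset.mem_univ _, hrr⟩⟩
    rw [Finset.coe_insert, Set.image_insert_eq, Set.insert_eq, Set.union_comm, Ideal.span_union,
      Finset.sum_insert hr, Finset.card_insert_of_notMem hr]
    have hf := isHomogeneous_fibreProd (K := K) ρ r
    generalize (Finset.univ.filter (ρ · = r)).card = e at *
    -- A generator `Sum.inl a` keeps its degree while the total grows by `e ≥ 1`; this gives both
    -- the regularity bound and the strict inequality. A generator `Sum.inr a` moves up one position
    -- and gains degree `e`.
    refine ⟨A.cone he hf (fibreProd_regular hρ hs' hrr hr), ?_, Sum.inr a₀, ?_⟩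
    · intro i a
      match i, a with
      | 0, a =>
        have h := hA 0 a
        refine ⟨by omega, ?_, fun _ => ?_⟩
        · change A.deg 0 a + _ ≤ _
          omega
        · change A.deg 0 a < _
          omega
      | i + 1, Sum.inl a =>
        have h := hA (i + 1) a
        refine ⟨by omega, ?_, fun _ => ?_⟩
        · change A.deg (i + 1) a + _ ≤ _
          omega
        · change A.deg (i + 1) a < _
          omega
      | i + 1, Sum.inr a =>
        have h := hA i a
        refine ⟨by omega, ?_, fun _ => ?_⟩
        · change A.deg i a + e + _ ≤ _
          omega
        · change A.deg i a + e < _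
          omega
    · change A.deg s.card a₀ + e = _
      omega

/-- The extremal shape of the graded Betti numbers of an ideal generated by products over
fibres. -/
theorem gradedBetti_fibreIdeal (hρ : ∀ j, ρ (ρ j) = ρ j) {t : ℕ}
    (ht : (Finset.univ.filter fun r => ρ r = r).card = t) (ht1 : 1 ≤ t) :
    (∀ i j, gradedBetti (fibreIdeal ρ K) i j ≠ 0 →
      i + 1 ≤ t ∧ j + t ≤ n + (i + 1) ∧ (i + 1 < t → j < n)) ∧
    gradedBetti (fibreIdeal ρ K) (t - 1) n ≠ 0 := by
  obtain ⟨A, hA, a₀, ha₀⟩ := exists_cyclicResolution (K := K) hρ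
    (Finset.univ.filter fun r => ρ r = r) (by simp)
  have hD : ∑ r ∈ Finset.univ.filter (fun r => ρ r = r), (Finset.univ.filter (ρ · = r)).card = n := by
    rw [← Finset.card_eq_sum_card_fiberwise (s := Finset.univ) (f := ρ), Finset.card_univ,
      Fintype.card_fin]
    intro j _
    simp [hρ]
  have hI : Ideal.span (fibreProd ρ K '' ↑(Finset.univ.filter fun r => ρ r = r)) =
      fibreIdeal ρ K := by
    rw [fibreIdeal, Finset.coe_filter_univ]
  subst ht
  rw [hD] at ha₀ hA
  rw [← hI]
  constructor
  · intro i j hij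
    rw [A.gradedBetti_eq_count] at hij
    obtain ⟨a, ha⟩ := Finset.card_pos.1 (Nat.pos_of_ne_zero hij)
    obtain rfl := (Finset.mem_filter.1 ha).2
    exact hA (i + 1) a
  · rw [A.gradedBetti_eq_count, Nat.sub_add_cancel ht1]
    exact (Finset.card_pos.2 ⟨a₀, Finset.mem_filter.2 ⟨Finset.mem_univ _, ha₀⟩⟩).ne'

end Koszul

end PascalIdeal

namespace PascalIdeal

open MvPolynomial

/-! ### Counting `t`-spread monomials -/

section Counting

/-- The `t`-spread subsets of `{0, …, n - 1}` with `d` elements. -/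
def spreadFinset (t n d : ℕ) : Finset (Finset ℕ) :=
  ((Finset.range n).powersetCard d).filter fun F => ∀ a ∈ F, ∀ b ∈ F, a < b → a + t ≤ b

lemma mem_spreadFinset {t n d : ℕ} {F : Finset ℕ} :
    F ∈ spreadFinset t n d ↔
      ((∀ a ∈ F, a < n) ∧ F.card = d) ∧ ∀ a ∈ F, ∀ b ∈ F, a < b → a + t ≤ b := by
  rw [spreadFinset, Finset.mem_filter, Finset.mem_powersetCard, Finset.subset_iff]
  simp only [Finset.mem_range]

/-- The sets are separated by whether they contain `n`; if they do, the other elements `a` satisfy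
`a + t ≤ n`, that is, `a < n + 1 - t`. -/
lemma spreadFinset_succ_succ {t : ℕ} (ht : 1 ≤ t) (n d : ℕ) :
    spreadFinset t (n + 1) (d + 1) =
      spreadFinset t n (d + 1) ∪ (spreadFinset t (n + 1 - t) d).image (insert n) := by
  ext F
  rw [Finset.mem_union, Finset.mem_image]
  constructor
  · intro hF
    obtain ⟨⟨hn, hd⟩, hs⟩ := mem_spreadFinset.1 hF
    by_cases hnF : n ∈ F
    · refine Or.inr ⟨F.erase n, mem_spreadFinset.2 ⟨⟨fun a ha => ?_, ?_⟩, fun a ha b hb =>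
        hs a (Finset.mem_of_mem_erase ha) b (Finset.mem_of_mem_erase hb)⟩, Finset.insert_erase hnF⟩
      · have h1 := Finset.ne_of_mem_erase ha
        have h2 := hn a (Finset.mem_of_mem_erase ha)
        have := hs a (Finset.mem_of_mem_erase ha) n hnF (by omega)
        omega
      · rw [Finset.card_erase_of_mem hnF, hd, Nat.add_sub_cancel]
    · refine Or.inl (mem_spreadFinset.2 ⟨⟨fun a ha => ?_, hd⟩, hs⟩)
      have h1 : a ≠ n := by rintro rfl; exact hnF ha
      have := hn a ha
      omega
  · rintro (hF | ⟨G, hG, rfl⟩)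
    · obtain ⟨⟨hn, hd⟩, hs⟩ := mem_spreadFinset.1 hF
      exact mem_spreadFinset.2 ⟨⟨fun a ha => (hn a ha).trans (Nat.lt_succ_self n), hd⟩, hs⟩
    · obtain ⟨⟨hn, hd⟩, hs⟩ := mem_spreadFinset.1 hG
      have hnG : n ∉ G := fun h => by have := hn n h; omega
      refine mem_spreadFinset.2 ⟨⟨fun a ha => ?_, ?_⟩, fun a ha b hb hab => ?_⟩
      · rcases Finset.mem_insert.1 ha with rfl | ha
        · omega
        · have := hn a ha
          omega
      · rw [Finset.card_insert_of_notMem hnG, hd]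
      · rcases Finset.mem_insert.1 ha with ha' | ha' <;>
          rcases Finset.mem_insert.1 hb with hb' | hb'
        · omega
        · have := hn b hb'
          omega
        · have := hn a ha'
          omega
        · exact hs a ha' b hb' hab

lemma card_spreadFinset_succ_succ {t : ℕ} (ht : 1 ≤ t) (n d : ℕ) :
    (spreadFinset t (n + 1) (d + 1)).card =
      (spreadFinset t n (d + 1)).card + (spreadFinset t (n + 1 - t) d).card := by
  have hn {G : Finset ℕ} (hG : G ∈ spreadFinset t (n + 1 - t) d) : n ∉ G := fun h => by
    have := (mem_spreadFinset.1 hG).1.1 n h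
    omega
  rw [spreadFinset_succ_succ ht, Finset.card_union_of_disjoint, Finset.card_image_of_injOn]
  · intro G hG G' hG' h
    rw [← Finset.erase_insert (hn hG), ← Finset.erase_insert (hn hG')]
    exact congrArg (Finset.erase · n) h
  · rw [Finset.disjoint_left]
    intro F hF hF'
    obtain ⟨G, -, rfl⟩ := Finset.mem_image.1 hF'
    exact Nat.lt_irrefl n ((mem_spreadFinset.1 hF).1.1 n (Finset.mem_insert_self _ _))

/-- The recursion above becomes Pascal's rule. Adding `t - 1` before subtracting makes the truncated
formula valid for `d = 0` as well. -/
lemma card_spreadFinset {t : ℕ} (ht : 1 ≤ t) (n d : ℕ) :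
    (spreadFinset t n d).card = (n + (t - 1) - d * (t - 1)).choose d := by
  induction d generalizing n with
  | zero =>
    have : spreadFinset t n 0 = {∅} := by
      ext F
      rw [mem_spreadFinset, Finset.card_eq_zero, Finset.mem_singleton]
      exact ⟨fun h => h.1.2, by rintro rfl; simp⟩
    rw [this, Finset.card_singleton, Nat.choose_zero_right]
  | succ d ih =>
    have hmul : (d + 1) * (t - 1) = d * (t - 1) + (t - 1) := Nat.succ_mul _ _
    rw [hmul]
    induction n with
    | zero =>
      have : spreadFinset t 0 (d + 1) = ∅ := by
        refine Finset.eq_empty_of_forall_notMem fun F hF => ?_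
        obtain ⟨⟨hn, hd⟩, -⟩ := mem_spreadFinset.1 hF
        obtain ⟨a, ha⟩ := Finset.card_pos.1 (show 0 < F.card by omega)
        exact Nat.not_lt_zero _ (hn a ha)
      rw [this, Finset.card_empty, Nat.choose_eq_zero_of_lt]
      omega
    | succ n ihn =>
      rw [card_spreadFinset_succ_succ ht, ihn, ih]
      -- The case `d = 0` is apart because for `n + 1 < t` the empty set still contributes `1`,
      -- while for `d > 0` all three binomials vanish there.
      rcases Nat.eq_zero_or_pos d with rfl | hd0
      · simp only [Nat.zero_mul, zero_add, Nat.choose_one_right, Nat.choose_zero_right]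
        omega
      · have hd : t - 1 ≤ d * (t - 1) := Nat.le_mul_of_pos_left _ hd0
        generalize d * (t - 1) = m at hd
        by_cases hnt : t ≤ n + 1
        · rw [show n + 1 - t + (t - 1) - m = n - m by omega,
            show n + (t - 1) - (m + (t - 1)) = n - m by omega,
            show n + 1 + (t - 1) - (m + (t - 1)) = n + 1 - m by omega]
          rcases Nat.lt_or_ge n m with h | h
          · rw [show n - m = 0 by omega, show n + 1 - m = 0 by omega,
              Nat.choose_eq_zero_of_lt (Nat.succ_pos d), Nat.choose_eq_zero_of_lt (by omega)]
          · rw [show n + 1 - m = n - m + 1 by omega, Nat.choose_succ_succ, add_comm]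
        · rw [Nat.choose_eq_zero_of_lt (by omega), Nat.choose_eq_zero_of_lt (by omega),
            Nat.choose_eq_zero_of_lt (by omega)]

theorem ncard_tSpreadSet {t : ℕ} (ht : 1 ≤ t) (n d : ℕ) :
    (tSpreadSet n d t).ncard = (n - (d - 1) * (t - 1)).choose d := by
  have h1 : (tSpreadSet n d t).ncard = (spreadFinset t n d).card := by
    rw [← Set.ncard_coe_finset, ← Set.ncard_image_of_injective (tSpreadSet n d t)
      (Finset.map_injective (Fin.valEmbedding (n := n)))]
    congr 1
    ext F
    rw [Finset.mem_coe, mem_spreadFinset]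
    constructor
    · rintro ⟨G, ⟨hG, hs⟩, rfl⟩
      refine ⟨⟨by simp, by rw [Finset.card_map, hG]⟩, ?_⟩
      simp only [Finset.mem_map, Fin.valEmbedding_apply, forall_exists_index, and_imp,
        forall_apply_eq_imp_iff₂]
      exact hs
    · rintro ⟨⟨hn, hd⟩, hs⟩
      have hmap : (Finset.univ.filter fun a : Fin n => (a : ℕ) ∈ F).map Fin.valEmbedding = F := by
        ext a
        simp only [Finset.mem_map, Finset.mem_filter, Finset.mem_univ, true_and,
          Fin.valEmbedding_apply]
        exact ⟨by rintro ⟨b, hb, rfl⟩; exact hb, fun ha => ⟨⟨a, hn a ha⟩, ha, rfl⟩⟩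
      refine ⟨Finset.univ.filter fun a : Fin n => (a : ℕ) ∈ F, ⟨?_, ?_⟩, hmap⟩
      · rw [← hd, ← Finset.card_map Fin.valEmbedding, hmap]
      · intro a ha b hb hab
        exact hs a (Finset.mem_filter.1 ha).2 b (Finset.mem_filter.1 hb).2 hab
  rw [h1, card_spreadFinset ht]
  rcases d with _ | d
  · rw [Nat.choose_zero_right, Nat.choose_zero_right]
  · rw [Nat.succ_mul, Nat.add_sub_add_right, Nat.add_sub_cancel]

end Counting

/-! ### The `t`-spread monomials in the Pascal ideal -/

section Membership

variable {n : ℕ} {K : Type*} [Field K]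

lemma squarefreeMonomial_eq_monomial (F : Finset (Fin n)) :
    squarefreeMonomial K F = monomial (∑ a ∈ F, Finsupp.single a 1) 1 := by
  rw [squarefreeMonomial, monomial_sum_one]
  rfl

lemma sum_single_apply (F : Finset (Fin n)) (b : Fin n) :
    (∑ a ∈ F, Finsupp.single a 1 : Fin n →₀ ℕ) b = if b ∈ F then 1 else 0 := by
  simp [Finsupp.finsetSum_apply, Finsupp.single_apply]

theorem squarefreeMonomial_mem_span (G : Set (Finset (Fin n))) (F : Finset (Fin n)) :
    squarefreeMonomial K F ∈ Ideal.span (squarefreeMonomial K '' G) ↔ ∃ A ∈ G, A ⊆ F := by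
  have h : squarefreeMonomial K '' G = (fun m => monomial m (1 : K)) ''
      ((fun F => ∑ a ∈ F, Finsupp.single a 1) '' G) := by
    rw [Set.image_image]
    exact Set.image_congr fun F _ => squarefreeMonomial_eq_monomial F
  rw [h, mem_ideal_span_monomial_image, squarefreeMonomial_eq_monomial]
  have hle (A : Finset (Fin n)) : (∑ a ∈ A, Finsupp.single a 1 : Fin n →₀ ℕ) ≤
      ∑ a ∈ F, Finsupp.single a 1 ↔ A ⊆ F := by
    rw [Finsupp.le_def]
    simp only [sum_single_apply]
    refine forall_congr' fun b => ?_
    by_cases h1 : b ∈ A <;> by_cases h2 : b ∈ F <;> simp [h1, h2]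
  have hsupp : (monomial (∑ a ∈ F, Finsupp.single a 1) (1 : K)).support =
      {∑ a ∈ F, Finsupp.single a 1} := by
    classical
    rw [support_monomial, if_neg one_ne_zero]
  simp only [hsupp, Finset.mem_singleton, forall_eq, Set.exists_mem_image, hle]

lemma pascalIdeal_eq_span (t : ℕ) : pascalIdeal n t K =
    Ideal.span (squarefreeMonomial K '' (residueClass n t '' Set.Icc 1 t)) := by
  rw [pascalIdeal]
  congr 1
  ext f
  constructor
  · rintro ⟨i, h1, h2, rfl⟩
    exact ⟨_, ⟨i, ⟨h1, h2⟩, rfl⟩, rfl⟩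
  · rintro ⟨_, ⟨i, ⟨h1, h2⟩, rfl⟩, rfl⟩
    exact ⟨i, h1, h2, rfl⟩

lemma mem_residueClass {t r : ℕ} (hr : r ∈ Set.Icc 1 t) {j : Fin n} :
    j ∈ residueClass n t r ↔ (j : ℕ) % t = r - 1 := by
  obtain ⟨h1, h2⟩ := hr
  rw [residueClass, Finset.mem_filter, and_iff_right (Finset.mem_univ _)]
  obtain ⟨r, rfl⟩ := Nat.exists_eq_add_of_le' h1
  have : (j : ℕ) + 1 ≡ r + 1 [MOD t] ↔ (j : ℕ) ≡ r [MOD t] :=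
    ⟨Nat.ModEq.add_right_cancel' 1, Nat.ModEq.add_right 1⟩
  rw [this, Nat.add_sub_cancel, Nat.ModEq, Nat.mod_eq_of_lt (b := t) (a := r) (by omega)]

lemma isTSpread_residueClass {t r : ℕ} (hr : r ∈ Set.Icc 1 t) :
    IsTSpread t (residueClass n t r) := by
  intro a ha b hb hab
  rw [mem_residueClass hr] at ha hb
  have h1 := Nat.div_add_mod (a : ℕ) t
  have h2 := Nat.div_add_mod (b : ℕ) t
  have hab : (a : ℕ) < b := hab
  rw [ha] at h1
  rw [hb] at h2
  have h3 : (a : ℕ) / t < b / t := by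
    by_contra! h
    have := Nat.mul_le_mul_left t h
    omega
  have := Nat.mul_le_mul_left t (Nat.succ_le_of_lt h3)
  rw [Nat.mul_succ] at this
  omega

/-- Every index is at distance less than `t` from some member of a given residue class, so a
`t`-spread set containing the class has no room for another element. -/
lemma eq_residueClass_of_subset {t r : ℕ} (htn : t ≤ n) (hr : r ∈ Set.Icc 1 t)
    {F : Finset (Fin n)} (hF : IsTSpread t F) (h : residueClass n t r ⊆ F) :
    F = residueClass n t r := by
  refine Finset.Subset.antisymm (fun x hx => ?_) h
  obtain ⟨h1, h2⟩ := id hr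
  -- The neighbour is the largest member of the class not exceeding `x`, or the least member `r - 1`
  -- if `x` lies below it; `t ≤ n` ensures that the latter exists.
  obtain ⟨y, hy, hxy⟩ : ∃ y : Fin n, y ∈ residueClass n t r ∧
      (x : ℕ) < y + t ∧ (y : ℕ) < x + t := by
    by_cases hxr : r - 1 ≤ (x : ℕ)
    · have h3 := Nat.mod_lt ((x : ℕ) - (r - 1)) (show 0 < t by omega)
      have h4 := Nat.div_add_mod ((x : ℕ) - (r - 1)) t
      refine ⟨⟨x - (x - (r - 1)) % t, by omega⟩, ?_, by simp only; omega, by simp only; omega⟩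
      rw [mem_residueClass hr]
      have : (x : ℕ) - (x - (r - 1)) % t = r - 1 + t * ((x - (r - 1)) / t) := by omega
      simp only [this, Nat.add_mul_mod_self_left]
      exact Nat.mod_eq_of_lt (by omega)
    · refine ⟨⟨r - 1, by omega⟩, ?_, by simp only; omega, by simp only; omega⟩
      rw [mem_residueClass hr]
      exact Nat.mod_eq_of_lt (show r - 1 < t by omega)
  rcases lt_trichotomy x y with hlt | rfl | hlt
  · have := hF x hx y (h hy) hlt
    omega
  · exact hy
  · have := hF y (h hy) x hx hlt
    omega

lemma tSpreadPart_pascalIdeal {t : ℕ} (htn : t ≤ n) (d : ℕ) :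
    tSpreadPart (pascalIdeal n t K) d t =
      residueClass n t '' {r | r ∈ Set.Icc 1 t ∧ (residueClass n t r).card = d} := by
  ext F
  constructor
  · rintro ⟨⟨hd, hF⟩, hm⟩
    rw [pascalIdeal_eq_span, squarefreeMonomial_mem_span] at hm
    obtain ⟨_, ⟨r, hr, rfl⟩, hsub⟩ := hm
    have := eq_residueClass_of_subset htn hr hF hsub
    exact ⟨r, ⟨hr, this ▸ hd⟩, this.symm⟩
  · rintro ⟨r, ⟨hr, hd⟩, rfl⟩
    refine ⟨⟨hd, isTSpread_residueClass hr⟩, ?_⟩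
    rw [pascalIdeal_eq_span, squarefreeMonomial_mem_span]
    exact ⟨_, ⟨r, hr, rfl⟩, Finset.Subset.refl _⟩

lemma card_residueClass {t k i r : ℕ} (hn : n = k * t + i) (hi : i ∈ Set.Icc 1 t)
    (hr : r ∈ Set.Icc 1 t) : (residueClass n t r).card = if r ≤ i then k + 1 else k := by
  obtain ⟨hi1, hi2⟩ := hi
  obtain ⟨hr1, hr2⟩ := id hr
  have h1 : (residueClass n t r).card = Nat.count (· ≡ r - 1 [MOD t]) n := by
    rw [Nat.count_eq_card_filter_range, ← Finset.card_map Fin.valEmbedding]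
    congr 1
    ext a
    simp only [Finset.mem_map, mem_residueClass hr, Fin.valEmbedding_apply, Finset.mem_filter,
      Finset.mem_range, Nat.ModEq, Nat.mod_eq_of_lt (show r - 1 < t by omega)]
    exact ⟨by rintro ⟨b, hb, rfl⟩; exact ⟨b.2, hb⟩, fun ⟨ha, ha'⟩ => ⟨⟨a, ha⟩, ha', rfl⟩⟩
  rw [h1, Nat.count_modEq_card _ (by omega), Nat.mod_eq_of_lt (show r - 1 < t by omega), hn]
  -- For `i = t` the expression `k * t + i` is not a division with remainder: the quotient is `k +
  -- 1` and the remainder `0`.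
  rcases hi2.lt_or_eq with h | rfl
  · rw [Nat.mul_comm, Nat.mul_add_div (by omega), Nat.div_eq_of_lt h, Nat.mul_add_mod,
      Nat.mod_eq_of_lt h]
    split_ifs <;> omega
  · rw [← Nat.succ_mul, Nat.mul_div_cancel _ (by omega), Nat.mul_mod_left, if_pos hr2,
      if_neg (Nat.not_lt_zero _)]

lemma ncard_tSpreadPart_pascalIdeal {t k i : ℕ} (htn : t ≤ n) (hn : n = k * t + i)
    (hi : i ∈ Set.Icc 1 t) (d : ℕ) : (tSpreadPart (pascalIdeal n t K) d t).ncard =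
      if d = k + 1 then i else if d = k then t - i else 0 := by
  -- Since `t ≤ n`, the class of `r` contains the index `r - 1`, which determines `r`.
  have hinj : Set.InjOn (residueClass n t) (Set.Icc 1 t) := by
    intro r hr r' hr' h
    obtain ⟨h1, h2⟩ := id hr
    obtain ⟨h1', -⟩ := id hr'
    have hm : (⟨r - 1, by omega⟩ : Fin n) ∈ residueClass n t r := by
      rw [mem_residueClass hr]
      exact Nat.mod_eq_of_lt (show r - 1 < t by omega)
    have hm' := hm
    rw [h, mem_residueClass hr'] at hm'
    rw [mem_residueClass hr] at hm
    omega
  rw [tSpreadPart_pascalIdeal htn, (hinj.mono fun r hr => hr.1).ncard_image]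
  obtain ⟨hi1, hi2⟩ := id hi
  have h1 : {r | r ∈ Set.Icc 1 t ∧ (residueClass n t r).card = d} =
      ↑(if d = k + 1 then Finset.Icc 1 i else if d = k then Finset.Icc (i + 1) t else ∅) := by
    ext r
    change (r ∈ Set.Icc 1 t ∧ (residueClass n t r).card = d) ↔ _
    rw [Finset.mem_coe]
    by_cases hr : r ∈ Set.Icc 1 t
    · rw [card_residueClass hn hi hr, and_iff_right hr]
      obtain ⟨hr1, hr2⟩ := hr
      split_ifs <;> simp only [Finset.mem_Icc, Finset.notMem_empty, iff_false] <;> omega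
    · refine iff_of_false (fun h => hr h.1) fun h => hr ?_
      rw [Set.mem_Icc]
      split_ifs at h <;> simp only [Finset.mem_Icc, Finset.notMem_empty] at h <;> omega
  rw [h1, Set.ncard_coe_finset]
  split_ifs <;> simp

end Membership

end PascalIdeal

namespace PascalIdeal

/-! ### `t`-spread lexsegment ideals with prescribed `f_t`-vector -/

section Lex

variable {n : ℕ}

/-- The indicator function of `F` in the lexicographic order, which induces `SlexGE`. -/
def lexKey (F : Finset (Fin n)) : Lex (Fin n → Bool) :=
  toLex fun a => decide (a ∈ F)

lemma lexKey_injective : Function.Injective (lexKey (n := n)) := fun F G h => by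
  ext a
  have := congrFun (toLex.injective h) a
  simpa using this

lemma slexGE_iff {F G : Finset (Fin n)} : SlexGE F G ↔ lexKey G ≤ lexKey F := by
  rw [le_iff_eq_or_lt, SlexGE, lexKey_injective.eq_iff, eq_comm (a := F)]
  refine or_congr Iff.rfl (exists_congr fun a => ?_)
  simp only [lexKey, Pi.toLex_apply]
  by_cases h1 : a ∈ F <;> by_cases h2 : a ∈ G <;> simp [h1, h2, iff_comm]

lemma exists_upper_subset {α β : Type*} [DecidableEq α] [LinearOrder β] {f : α → β}
    (hf : Function.Injective f) (M : Finset α) {m : ℕ} (hm : m ≤ M.card) :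
    ∃ U ⊆ M, U.card = m ∧ ∀ u ∈ U, ∀ v ∈ M, f u ≤ f v → v ∈ U := by
  induction m with
  | zero => exact ⟨∅, by simp, rfl, by simp⟩
  | succ m ih =>
    obtain ⟨U, hUM, hU, hup⟩ := ih (by omega)
    have hne : (M \ U).Nonempty := by
      rw [← Finset.card_pos, Finset.card_sdiff_of_subset hUM]
      omega
    obtain ⟨x, hx, hmax⟩ := Finset.exists_max_image _ f hne
    rw [Finset.mem_sdiff] at hx
    refine ⟨insert x U, Finset.insert_subset hx.1 hUM, by
      rw [Finset.card_insert_of_notMem hx.2, hU], fun u hu v hv huv => ?_⟩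
    rcases Finset.mem_insert.1 hu with rfl | hu
    · by_cases hvU : v ∈ U
      · exact Finset.mem_insert_of_mem hvU
      · rw [hf ((hmax v (Finset.mem_sdiff.2 ⟨hv, hvU⟩)).antisymm huv)]
        exact Finset.mem_insert_self _ _
    · exact Finset.mem_insert_of_mem (hup u hu v hv huv)

lemma exists_slex_upper_subset {t d m : ℕ} (hm : m ≤ (tSpreadSet n d t).ncard) :
    ∃ U ⊆ tSpreadSet n d t, U.ncard = m ∧
      ∀ u ∈ U, ∀ v ∈ tSpreadSet n d t, SlexGE v u → v ∈ U := by
  classical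
  have hfin := (tSpreadSet n d t).toFinite
  rw [Set.ncard_eq_toFinset_card _ hfin] at hm
  obtain ⟨U, hUM, hU, hup⟩ := exists_upper_subset lexKey_injective hfin.toFinset hm
  simp only [Finset.subset_iff, hfin.mem_toFinset] at hUM hup
  exact ⟨U, hUM, by rw [Set.ncard_coe_finset, hU],
    fun u hu v hv h => hup u hu v hv (slexGE_iff.1 h)⟩

lemma IsTSpread.mono {t : ℕ} {F G : Finset (Fin n)} (hG : IsTSpread t G) (h : F ⊆ G) :
    IsTSpread t F :=
  fun a ha b hb => hG a (h ha) b (h hb)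

lemma IsTSpread.insert {t : ℕ} {F : Finset (Fin n)} (hF : IsTSpread t F) {x : Fin n}
    (hx : ∀ a ∈ F, (a : ℕ) + t ≤ x) : IsTSpread t (insert x F) := by
  intro a ha b hb hab
  have hab' : (a : ℕ) < b := hab
  rcases Finset.mem_insert.1 ha with ha' | ha' <;> rcases Finset.mem_insert.1 hb with hb' | hb'
  · rw [ha', hb'] at hab'
    omega
  · have := hx b hb'
    rw [ha'] at hab'
    omega
  · rw [hb']
    exact hx a ha'
  · exact hF a ha' b hb' hab

/-- A family of slex-upper sets of `t`-spread monomials that is closed under `t`-spread multiples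
is the family of `t`-spread parts of a `t`-spread lexsegment ideal. -/
lemma exists_isTSpreadLexIdeal (K : Type*) [Field K] {t : ℕ} (U : ℕ → Set (Finset (Fin n)))
    (hU : ∀ d, U d ⊆ tSpreadSet n d t)
    (hup : ∀ d, ∀ u ∈ U d, ∀ v ∈ tSpreadSet n d t, SlexGE v u → v ∈ U d)
    (hsh : ∀ d, ∀ u ∈ U d, ∀ v ∈ tSpreadSet n (d + 1) t, u ⊆ v → v ∈ U (d + 1)) :
    ∃ L : Ideal (MvPolynomial (Fin n) K), IsTSpreadLexIdeal t L ∧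
      ∀ d, tSpreadPart L d t = U d := by
  -- Closure under multiples of one degree higher is iterated; the intermediate sets are `t-`spread
  -- as subsets of `v`.
  have key (m : ℕ) : ∀ d, ∀ u ∈ U d, ∀ v ∈ tSpreadSet n (d + m) t, u ⊆ v → v ∈ U (d + m) := by
    induction m with
    | zero =>
      intro d u hu v hv huv
      rwa [← Finset.eq_of_subset_of_card_le huv (by rw [hv.1, (hU d hu).1, Nat.add_zero])]
    | succ m ih =>
      intro d u hu v hv huv
      obtain ⟨w, huw, hwv, hw⟩ := Finset.exists_subsuperset_card_eq huv (n := d + m)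
        (by rw [(hU d hu).1]; omega) (by rw [hv.1]; omega)
      exact hsh _ w (ih d u hu w ⟨hw, hv.2.mono hwv⟩ huw) v hv hwv
  have hpart (d : ℕ) :
      tSpreadPart (Ideal.span (squarefreeMonomial K '' ⋃ d, U d)) d t = U d := by
    ext F
    constructor
    · rintro ⟨hF, hm⟩
      obtain ⟨A, hA, hAF⟩ := (squarefreeMonomial_mem_span _ F).1 hm
      obtain ⟨e, hA⟩ := Set.mem_iUnion.1 hA
      obtain ⟨m, rfl⟩ : ∃ m, d = e + m := by
        refine Nat.exists_eq_add_of_le ?_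
        rw [← (hU e hA).1, ← hF.1]
        exact Finset.card_le_card hAF
      exact key m e A hA F hF hAF
    · exact fun hF => ⟨hU d hF, (squarefreeMonomial_mem_span _ F).2
        ⟨F, Set.mem_iUnion.2 ⟨d, hF⟩, Finset.Subset.refl _⟩⟩
  refine ⟨_, ⟨⟨⋃ d, U d, fun F hF => ?_, rfl⟩, fun d => ?_⟩, hpart⟩
  · obtain ⟨d, hd⟩ := Set.mem_iUnion.1 hF
    exact (hU d hd).2
  · rw [hpart]
    exact hup d

lemma tSpreadSet_eq_empty {t d : ℕ} (ht : 1 ≤ t) (hd : n ≤ d * t) :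
    tSpreadSet n (d + 1) t = ∅ := by
  rw [← Set.ncard_eq_zero (Set.toFinite _), ncard_tSpreadSet ht]
  refine Nat.choose_eq_zero_of_lt ?_
  obtain ⟨t, rfl⟩ := Nat.exists_eq_add_of_le' ht
  rw [Nat.mul_succ] at hd
  simp only [Nat.add_sub_cancel]
  omega

/-- The set `{0, t, …, (k - 1) t}`. -/
def initialSpread (n t k : ℕ) : Finset (Fin n) :=
  Finset.univ.filter fun j : Fin n => t ∣ (j : ℕ) ∧ (j : ℕ) < k * t

lemma mem_initialSpread {t k : ℕ} {j : Fin n} :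
    j ∈ initialSpread n t k ↔ t ∣ (j : ℕ) ∧ (j : ℕ) < k * t := by
  simp [initialSpread]

lemma add_le_of_mem_initialSpread {t k : ℕ} {a : Fin n} (ha : a ∈ initialSpread n t k) :
    (a : ℕ) + t ≤ k * t := by
  obtain ⟨⟨q, hq⟩, hk⟩ := mem_initialSpread.1 ha
  rw [hq, Nat.mul_comm t q] at hk ⊢
  rw [← Nat.succ_mul]
  exact Nat.mul_le_mul_right t (lt_of_mul_lt_mul_right hk (Nat.zero_le t))

lemma isTSpread_initialSpread (t k : ℕ) : IsTSpread t (initialSpread n t k) := by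
  intro a ha b hb hab
  obtain ⟨⟨p, hp⟩, -⟩ := mem_initialSpread.1 ha
  obtain ⟨⟨q, hq⟩, -⟩ := mem_initialSpread.1 hb
  have hab' : (a : ℕ) < b := hab
  rw [hp, hq] at hab' ⊢
  rw [← Nat.mul_succ]
  exact Nat.mul_le_mul_left t (lt_of_mul_lt_mul_left hab' (Nat.zero_le t))

lemma notMem_initialSpread {t k : ℕ} {j : Fin n} (hj : k * t ≤ j) : j ∉ initialSpread n t k :=
  fun h => (mem_initialSpread.1 h).2.not_ge hj

lemma isTSpread_insert_initialSpread {t k : ℕ} {j : Fin n} (hj : k * t ≤ j) :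
    IsTSpread t (insert j (initialSpread n t k)) :=
  (isTSpread_initialSpread t k).insert fun _ ha => (add_le_of_mem_initialSpread ha).trans hj

lemma initialSpread_succ {t k : ℕ} (ht : 1 ≤ t) (h : k * t < n) :
    initialSpread n t (k + 1) = insert ⟨k * t, h⟩ (initialSpread n t k) := by
  ext j
  rw [Finset.mem_insert, mem_initialSpread, mem_initialSpread, Fin.ext_iff, Nat.succ_mul]
  constructor
  · rintro ⟨⟨q, hq⟩, hk⟩
    rcases Nat.lt_or_ge j (k * t) with h1 | h1
    · exact Or.inr ⟨⟨q, hq⟩, h1⟩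
    · refine Or.inl (le_antisymm ?_ h1)
      rw [hq, Nat.mul_comm t q, ← Nat.succ_mul] at hk
      rw [hq, Nat.mul_comm t q]
      exact Nat.mul_le_mul_right t (Nat.le_of_lt_succ (lt_of_mul_lt_mul_right hk (Nat.zero_le t)))
  · rintro (h1 | ⟨h1, h2⟩)
    · simp only at h1
      exact ⟨h1 ▸ Dvd.intro_left k rfl, by omega⟩
    · exact ⟨h1, by omega⟩

lemma card_initialSpread {t k : ℕ} (ht : 1 ≤ t) (h : k * t ≤ n) :
    (initialSpread n t k).card = k := by
  induction k with
  | zero => simp [initialSpread]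
  | succ k ih =>
    rw [Nat.succ_mul] at h
    rw [initialSpread_succ ht (by omega), Finset.card_insert_of_notMem
      (notMem_initialSpread le_rfl), ih (by omega)]

lemma initialSpread_mem_tSpreadSet {t k : ℕ} (ht : 1 ≤ t) (h : k * t ≤ n) :
    initialSpread n t k ∈ tSpreadSet n k t :=
  ⟨card_initialSpread ht h, isTSpread_initialSpread t k⟩

/-- In a `t`-spread set that agrees below `a` with a set containing `{0, t, …, (k - 1) t}`, the
element `a` cannot be new unless `a ≥ k t`. -/
lemma mul_le_of_agree {t k : ℕ} (ht : 1 ≤ t) {F G : Finset (Fin n)} (hG : IsTSpread t G)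
    (hF : initialSpread n t k ⊆ F) {a : Fin n} (haG : a ∈ G) (haF : a ∉ F)
    (h : ∀ b < a, (b ∈ G ↔ b ∈ F)) : k * t ≤ a := by
  by_contra! hlt
  have h1 := Nat.div_add_mod' (a : ℕ) t
  have h2 := Nat.mod_lt (a : ℕ) ht
  -- The multiple of `t` just below `a` belongs to `F`, hence to `G` by agreement, and is closer to
  -- `a` than `t`.
  have hb : (⟨a / t * t, by omega⟩ : Fin n) ∈ F :=
    hF (mem_initialSpread.2 ⟨Dvd.intro_left _ rfl, by simp only; omega⟩)
  have hba : (⟨a / t * t, by omega⟩ : Fin n) < a := by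
    refine lt_of_le_of_ne (Fin.le_def.2 (by simp only; omega)) fun h => haF (h ▸ hb)
  have := hG _ ((h _ hba).2 hb) a haG hba
  simp only at this
  omega

/-- The first difference can only occur at or beyond `k * t`, where the initial part is already
settled. Hence the multiples of the largest monomial form an slex-upper set. -/
lemma initialSpread_subset_of_slexGE {t k : ℕ} (ht : 1 ≤ t) {F G : Finset (Fin n)}
    (hG : IsTSpread t G) (hF : initialSpread n t k ⊆ F) (h : SlexGE G F) :
    initialSpread n t k ⊆ G := by
  obtain rfl | ⟨a, haG, haF, hagree⟩ := h
  · exact hF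
  · have hka := mul_le_of_agree ht hG hF haG haF hagree
    intro b hb
    exact (hagree b (Fin.lt_def.2 ((mem_initialSpread.1 hb).2.trans_le hka))).2 (hF hb)

lemma eq_initialSpread_of_subset {t k : ℕ} (ht : 1 ≤ t) (h : k * t ≤ n) {F : Finset (Fin n)}
    (hF : F ∈ tSpreadSet n k t) (hsub : initialSpread n t k ⊆ F) : F = initialSpread n t k :=
  (Finset.eq_of_subset_of_card_le hsub (by rw [hF.1, card_initialSpread ht h])).symm

lemma slexGE_of_not {F G : Finset (Fin n)} (h : SlexGE G F → F = G) : SlexGE F G := by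
  rw [slexGE_iff] at h ⊢
  rcases le_total (lexKey G) (lexKey F) with h1 | h1
  · exact h1
  · rw [h h1]

lemma initialSpread_slexGE {t k : ℕ} (ht : 1 ≤ t) (h : k * t ≤ n) {F : Finset (Fin n)}
    (hF : F ∈ tSpreadSet n k t) : SlexGE (initialSpread n t k) F :=
  slexGE_of_not fun hge => (eq_initialSpread_of_subset ht h hF
    (initialSpread_subset_of_slexGE ht hF.2 (Finset.Subset.refl _) hge)).symm

/-- The second largest `t`-spread monomial. -/
lemma insert_initialSpread_slexGE {t k : ℕ} (ht : 1 ≤ t) (h : k * t + 1 < n) (h' : (k + 1) * t ≤ n)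
    {F : Finset (Fin n)} (hF : F ∈ tSpreadSet n (k + 1) t) (hne : F ≠ initialSpread n t (k + 1)) :
    SlexGE (insert ⟨k * t + 1, h⟩ (initialSpread n t k)) F := by
  have hcard : (insert ⟨k * t + 1, h⟩ (initialSpread n t k) : Finset (Fin n)).card = k + 1 := by
    rw [Finset.card_insert_of_notMem (notMem_initialSpread (Nat.le_succ _)),
      card_initialSpread ht (by omega)]
  refine slexGE_of_not fun hge => ?_
  have hsub := initialSpread_subset_of_slexGE ht hF.2 (Finset.subset_insert _ _) hge
  obtain rfl | ⟨a, haF, ha, hagree⟩ := hge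
  · rfl
  have hka := mul_le_of_agree ht hF.2 (Finset.subset_insert _ _) haF ha hagree
  refine Finset.eq_of_subset_of_card_le (Finset.insert_subset ?_ hsub) (by rw [hcard, hF.1])
  have h1 : (a : ℕ) ≠ k * t := fun h1 => by
    refine hne (eq_initialSpread_of_subset ht h' hF ?_)
    rw [initialSpread_succ ht (by omega)]
    refine Finset.insert_subset ?_ hsub
    convert haF
    exact h1.symm
  have h2 : (a : ℕ) ≠ k * t + 1 := fun h2 => ha (Finset.mem_insert.2 (Or.inl (Fin.ext h2)))
  exact (hagree _ (Fin.lt_def.2 (by simp only; omega))).2 (Finset.mem_insert_self _ _)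

lemma setOf_initialSpread_subset {t k : ℕ} (ht : 1 ≤ t) (h : k * t ≤ n) :
    {F | F ∈ tSpreadSet n (k + 1) t ∧ initialSpread n t k ⊆ F} =
      (fun j => insert j (initialSpread n t k)) '' {j : Fin n | k * t ≤ j} := by
  ext F
  constructor
  · rintro ⟨hF, hsub⟩
    obtain ⟨j, hj, rfl⟩ := Finset.exists_eq_insert_iff.2
      ⟨hsub, by rw [card_initialSpread ht h, hF.1]⟩
    exact ⟨j, mul_le_of_agree ht (F := (insert j (initialSpread n t k)).erase j) hF.2
      (by rw [Finset.erase_insert hj]) (Finset.mem_insert_self _ _) (Finset.notMem_erase _ _)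
      (fun b hb => by simp [hb.ne]), rfl⟩
  · rintro ⟨j, hj, rfl⟩
    exact ⟨⟨by rw [Finset.card_insert_of_notMem (notMem_initialSpread hj),
      card_initialSpread ht h], isTSpread_insert_initialSpread hj⟩, Finset.subset_insert _ _⟩

lemma ncard_setOf_initialSpread_subset {t k : ℕ} (ht : 1 ≤ t) (h : k * t ≤ n) :
    {F | F ∈ tSpreadSet n (k + 1) t ∧ initialSpread n t k ⊆ F}.ncard = n - k * t := by
  rw [setOf_initialSpread_subset ht h, Set.InjOn.ncard_image]
  · have : {j : Fin n | k * t ≤ j} = ((Finset.Ico (k * t) n).attachFin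
        fun m hm => (Finset.mem_Ico.1 hm).2 : Finset (Fin n)) := by
      ext j
      simp
    rw [this, Set.ncard_coe_finset, Finset.card_attachFin, Nat.card_Ico]
  · intro j hj j' hj' hjj'
    have hjj' : insert j (initialSpread n t k) = insert j' (initialSpread n t k) := hjj'
    have : j ∈ insert j' (initialSpread n t k) := hjj' ▸ Finset.mem_insert_self _ _
    exact (Finset.mem_insert.1 this).resolve_right (notMem_initialSpread hj)

/-! ### Lexsegment ideals with the `f_t`-vector of the Pascal ideal -/

section Existence

variable (K : Type*) [Field K]

/-- There are no `t`-spread monomials of degree `k + 2`, so the only closure condition is the one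
from `V` to `W`. -/
lemma exists_isTSpreadLexIdeal_of_two_degrees {t k : ℕ} (ht : 1 ≤ t) (hk : n ≤ (k + 1) * t)
    {V W : Set (Finset (Fin n))} (hV : V ⊆ tSpreadSet n k t) (hW : W ⊆ tSpreadSet n (k + 1) t)
    (hVup : ∀ u ∈ V, ∀ v ∈ tSpreadSet n k t, SlexGE v u → v ∈ V)
    (hWup : ∀ u ∈ W, ∀ v ∈ tSpreadSet n (k + 1) t, SlexGE v u → v ∈ W)
    (hVW : ∀ u ∈ V, ∀ v ∈ tSpreadSet n (k + 1) t, u ⊆ v → v ∈ W) :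
    ∃ L : Ideal (MvPolynomial (Fin n) K), IsTSpreadLexIdeal t L ∧ ∀ d,
      (tSpreadPart L d t).ncard = if d = k + 1 then W.ncard else if d = k then V.ncard else 0 := by
  obtain ⟨L, hL, hpart⟩ := exists_isTSpreadLexIdeal K (t := t)
    (fun d => if d = k + 1 then W else if d = k then V else ∅) (fun d => by
      split_ifs with h1 h2
      · exact h1 ▸ hW
      · exact h2 ▸ hV
      · exact Set.empty_subset _) (fun d => by
      split_ifs with h1 h2
      · exact h1 ▸ hWup
      · exact h2 ▸ hVup
      · simp) (fun d u hu v hv huv => by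
      split_ifs at hu with h1 h2
      · subst h1
        rw [tSpreadSet_eq_empty ht hk] at hv
        exact hv.elim
      · subst h2
        rw [if_pos rfl]
        exact hVW u hu v hv huv
      · exact hu.elim)
  refine ⟨L, hL, fun d => ?_⟩
  rw [hpart]
  split_ifs
  · rfl
  · rfl
  · exact Set.ncard_empty _

theorem exists_isTSpreadLexIdeal_ncard_iff {t k i : ℕ} (htn : t ≤ n) (hn : n = k * t + i)
    (hi : i ∈ Set.Icc 1 t) :
    (∃ L : Ideal (MvPolynomial (Fin n) K), IsTSpreadLexIdeal t L ∧ ∀ d,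
      (tSpreadPart L d t).ncard = (tSpreadPart (pascalIdeal n t K) d t).ncard) ↔
    i = 1 ∨ i = t - 1 ∨ i = t := by
  obtain ⟨hi1, hit⟩ := id hi
  have ht : 1 ≤ t := hi1.trans hit
  have hpascal := ncard_tSpreadPart_pascalIdeal (K := K) htn hn hi
  have hk1 : n ≤ (k + 1) * t := by
    rw [Nat.succ_mul]
    omega
  have hle (d : ℕ) : (tSpreadPart (pascalIdeal n t K) d t).ncard ≤ (tSpreadSet n d t).ncard :=
    Set.ncard_le_ncard (fun F hF => hF.1) (Set.toFinite _)
  simp only [hpascal] at hle ⊢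
  have hlek := hle k
  have hlek1 := hle (k + 1)
  rw [if_neg (by omega), if_pos rfl] at hlek
  rw [if_pos rfl] at hlek1
  obtain ⟨V, hV, hVcard, hVup⟩ := exists_slex_upper_subset hlek
  obtain ⟨W, hW, hWcard, hWup⟩ := exists_slex_upper_subset hlek1
  constructor
  · rintro ⟨L, hL, hcard⟩
    by_contra! hcon
    obtain ⟨hc1, hc2, hc3⟩ := hcon
    -- For `k = 0` one has `n = t = i`, which is excluded here. From now on `k + 1` is the lower of
    -- the two degrees.
    obtain ⟨k, rfl⟩ : ∃ l, k = l + 1 := by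
      refine Nat.exists_eq_succ_of_ne_zero ?_
      rintro rfl
      omega
    have hcard1 := hcard (k + 1)
    have hcard2 := hcard (k + 1 + 1)
    rw [if_neg (by omega), if_pos rfl] at hcard1
    rw [if_pos rfl] at hcard2
    have hk : (k + 1) * t ≤ n := by omega
    have hkt : k * t + t = (k + 1) * t := (Nat.succ_mul k t).symm
    obtain ⟨w, hw, hne⟩ := Set.exists_ne_of_one_lt_ncard
      (show 1 < (tSpreadPart L (k + 1) t).ncard by omega) (initialSpread n t (k + 1))
    have hmem {d : ℕ} {F : Finset (Fin n)} (hF : squarefreeMonomial K F ∈ L)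
        {G : Finset (Fin n)} (hG : G ∈ tSpreadSet n d t) (hFG : F ⊆ G) : G ∈ tSpreadPart L d t := by
      refine ⟨hG, ?_⟩
      rw [squarefreeMonomial, ← Finset.prod_sdiff hFG]
      exact L.mul_mem_left _ hF
    have h0 := hL.2 _ w hw _ (initialSpread_mem_tSpreadSet ht hk) (initialSpread_slexGE ht hk hw.1)
    have hlt : k * t + 1 < n := by omega
    -- As `t - i ≥ 2`, `L` contains the two largest monomials of the lower degree: the initial one
    -- and `u`, in which `k * t` is moved to `k * t + 1`.
    set u : Finset (Fin n) := insert ⟨k * t + 1, hlt⟩ (initialSpread n t k) with hu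
    have huspread : u ∈ tSpreadSet n (k + 1) t :=
      ⟨by rw [hu, Finset.card_insert_of_notMem (notMem_initialSpread (Nat.le_succ _)),
        card_initialSpread ht (by omega)], isTSpread_insert_initialSpread (Nat.le_succ _)⟩
    have h1 := hL.2 _ w hw u huspread (insert_initialSpread_slexGE ht hlt hk hw.1 hne)
    -- As `i ≥ 2`, the index `(k + 1) * t + 1` is available. Adjoining it to `u` gives a monomial of
    -- `L` beyond the `i` multiples of the initial one.
    have hlt' : (k + 1) * t + 1 < n := by omega
    have hbound (a : Fin n) (ha : a ∈ u) : (a : ℕ) + t ≤ (k + 1) * t + 1 := by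
      rcases Finset.mem_insert.1 ha with rfl | ha
      · simp only
        omega
      · have := add_le_of_mem_initialSpread ha
        omega
    have hnotMem : (⟨(k + 1) * t + 1, hlt'⟩ : Fin n) ∉ u := fun h => by
      have := hbound _ h
      simp only at this
      omega
    have h2 : insert ⟨(k + 1) * t + 1, hlt'⟩ u ∈ tSpreadPart L (k + 1 + 1) t :=
      hmem h1.2 ⟨by rw [Finset.card_insert_of_notMem hnotMem, huspread.1],
        huspread.2.insert hbound⟩ (Finset.subset_insert _ _)
    have h3 : insert ⟨(k + 1) * t + 1, hlt'⟩ u ∉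
        {F | F ∈ tSpreadSet n (k + 1 + 1) t ∧ initialSpread n t (k + 1) ⊆ F} := by
      rintro ⟨-, hsub⟩
      have h4 := hsub ((initialSpread_succ ht (show k * t < n by omega)).symm ▸
        Finset.mem_insert_self _ _)
      rw [Finset.mem_insert, hu, Finset.mem_insert, Fin.ext_iff, Fin.ext_iff] at h4
      simp only at h4
      rcases h4 with h4 | h4 | h4
      · omega
      · omega
      · exact notMem_initialSpread le_rfl h4
    have h5 := Set.ncard_lt_ncard (Set.ssubset_iff_exists.2 ⟨fun F hF => hmem h0.2 hF.1 hF.2,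
      _, h2, h3⟩) (Set.toFinite (tSpreadPart L (k + 1 + 1) t))
    rw [ncard_setOf_initialSpread_subset ht hk] at h5
    omega
  · have hkn : k * t ≤ n := by omega
    rintro (rfl | hi' | rfl)
    -- For `i = 1` there is a single `t`-spread monomial of degree `k + 1`, so `W` is everything and
    -- imposes no condition on `V`.
    · have hWeq : W = tSpreadSet n (k + 1) t := by
        refine Set.eq_of_subset_of_ncard_le hW ?_ (Set.toFinite _)
        rw [hWcard, ncard_tSpreadSet ht, Nat.add_sub_cancel, hn]
        obtain ⟨s, rfl⟩ := Nat.exists_eq_add_of_le' ht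
        rw [Nat.add_sub_cancel, Nat.mul_succ,
          show k * s + k + 1 - k * s = k + 1 by omega, Nat.choose_self]
      obtain ⟨L, hL, hcard⟩ := exists_isTSpreadLexIdeal_of_two_degrees K ht hk1 hV hW hVup hWup
        fun u hu v hv huv => hWeq ▸ hv
      exact ⟨L, hL, fun d => by rw [hcard, hVcard, hWcard]⟩
    -- For `i = t - 1` one monomial is needed in degree `k`, and its `n - k * t = i` multiples are
    -- exactly the number needed in degree `k + 1`.
    · obtain ⟨L, hL, hcard⟩ := exists_isTSpreadLexIdeal_of_two_degrees K ht hk1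
        (V := {initialSpread n t k})
        (W := {F | F ∈ tSpreadSet n (k + 1) t ∧ initialSpread n t k ⊆ F})
        (Set.singleton_subset_iff.2 (initialSpread_mem_tSpreadSet ht hkn)) (fun F hF => hF.1)
        (by
          rintro _ rfl v hv h
          exact eq_initialSpread_of_subset ht hkn hv
            (initialSpread_subset_of_slexGE ht hv.2 (Finset.Subset.refl _) h))
        (fun u hu v hv h => ⟨hv, initialSpread_subset_of_slexGE ht hv.2 hu.2 h⟩)
        (by
          rintro _ rfl v hv h
          exact ⟨hv, h⟩)
      refine ⟨L, hL, fun d => ?_⟩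
      rw [hcard, Set.ncard_singleton, ncard_setOf_initialSpread_subset ht hkn,
        show n - k * t = i by omega, show t - i = 1 by omega]
    -- For `i = t` nothing is needed in degree `k`.
    · obtain ⟨L, hL, hcard⟩ := exists_isTSpreadLexIdeal_of_two_degrees K ht hk1
        (V := ∅) (Set.empty_subset _) hW (by simp) hWup (by simp)
      refine ⟨L, hL, fun d => ?_⟩
      rw [hcard, hWcard, Set.ncard_empty, Nat.sub_self]

end Existence

end Lex

end PascalIdeal

namespace PascalIdeal

/-! ### The Pascal ideal as a fibre ideal -/

section Main

variable {n t : ℕ}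

/-- The map `j ↦ j mod t` on `{0, …, n - 1}`. -/
def residue (n t : ℕ) (j : Fin n) : Fin n :=
  ⟨j % t, (Nat.mod_le _ _).trans_lt j.2⟩

lemma residue_residue (j : Fin n) : residue n t (residue n t j) = residue n t j :=
  Fin.ext (Nat.mod_mod _ _)

lemma residue_eq_self_iff (ht : 1 ≤ t) {j : Fin n} : residue n t j = j ↔ (j : ℕ) < t := by
  rw [Fin.ext_iff, residue, Nat.mod_eq_iff_lt (by omega)]

lemma filter_residue_eq {r : Fin n} (hr : (r : ℕ) < t) :
    (Finset.univ.filter fun j => residue n t j = r) = residueClass n t (r + 1) := by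
  ext j
  rw [mem_residueClass ⟨Nat.le_add_left 1 _, hr⟩, Finset.mem_filter,
    and_iff_right (Finset.mem_univ _), Fin.ext_iff, residue, Nat.add_sub_cancel]

lemma filter_residue_eq_self (ht : 1 ≤ t) (htn : t ≤ n) :
    (Finset.univ.filter fun j => residue n t j = j) =
      (Finset.range t).attachFin fun _ hm => (Finset.mem_range.1 hm).trans_le htn := by
  ext j
  rw [Finset.mem_filter, and_iff_right (Finset.mem_univ _), residue_eq_self_iff ht,
    Finset.mem_attachFin, Finset.mem_range]

lemma card_filter_residue_eq_self (ht : 1 ≤ t) (htn : t ≤ n) :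
    (Finset.univ.filter fun j => residue n t j = j).card = t := by
  rw [filter_residue_eq_self ht htn, Finset.card_attachFin, Finset.card_range]

lemma card_filter_residue_ne_self (ht : 1 ≤ t) (htn : t ≤ n) :
    (Finset.univ.filter fun j => residue n t j ≠ j).card = n - t := by
  have := Finset.card_filter_add_card_filter_not (s := (Finset.univ : Finset (Fin n)))
    (fun j => residue n t j = j)
  rw [card_filter_residue_eq_self ht htn, Finset.card_univ, Fintype.card_fin] at this
  exact (Nat.sub_eq_of_eq_add' this.symm).symm

lemma fibreProd_residue (K : Type*) [Field K] {r : Fin n} (hr : (r : ℕ) < t) :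
    fibreProd (residue n t) K r = squarefreeMonomial K (residueClass n t (r + 1)) := by
  rw [← filter_residue_eq hr]
  rfl

lemma pascalIdeal_eq_fibreIdeal (K : Type*) [Field K] (ht : 1 ≤ t) (htn : t ≤ n) :
    pascalIdeal n t K = fibreIdeal (residue n t) K := by
  rw [pascalIdeal, fibreIdeal]
  congr 1
  ext f
  constructor
  · rintro ⟨i, h1, h2, rfl⟩
    have hi : ((⟨i - 1, by omega⟩ : Fin n) : ℕ) < t := by simp only; omega
    refine ⟨_, (residue_eq_self_iff ht).2 hi, ?_⟩
    rw [fibreProd_residue K hi, Nat.sub_add_cancel h1]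
  · rintro ⟨r, hr, rfl⟩
    have hr' := (residue_eq_self_iff ht).1 hr
    exact ⟨r + 1, by omega, hr', fibreProd_residue K hr'⟩

/-- Each factor `1 - X ^ m` splits off `1 - X`, and the `t` copies cancel against `(1 - X) ^ n`. For
`k = 0` the second sum is empty, but then `i = t` and its zeroth power is `1`. -/
theorem hilbertSeries_pascalIdeal (K : Type*) [Field K] {k i : ℕ} (htn : t ≤ n)
    (hn : n = k * t + i) (hi : i ∈ Set.Icc 1 t) :
    hilbertSeries (pascalIdeal n t K) =
      (∑ l ∈ Finset.range (k + 1), (PowerSeries.X : PowerSeries ℚ) ^ l) ^ i *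
        (∑ l ∈ Finset.range k, (PowerSeries.X : PowerSeries ℚ) ^ l) ^ (t - i) *
        ((1 - (PowerSeries.X : PowerSeries ℚ)) ^ (n - t))⁻¹ := by
  obtain ⟨hi1, hit⟩ := id hi
  have ht : 1 ≤ t := hi1.trans hit
  have hprod : ∏ r ∈ Finset.univ.filter fun j => residue n t j = j,
      (1 - (PowerSeries.X : PowerSeries ℚ) ^
        (Finset.univ.filter fun j => residue n t j = r).card) =
      (1 - PowerSeries.X ^ (k + 1)) ^ i * (1 - PowerSeries.X ^ k) ^ (t - i) := by
    have h1 : ∏ r ∈ Finset.univ.filter fun j => residue n t j = j,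
        (1 - (PowerSeries.X : PowerSeries ℚ) ^
          (Finset.univ.filter fun j => residue n t j = r).card) =
        ∏ m ∈ Finset.range t, (1 - PowerSeries.X ^ (if m < i then k + 1 else k)) := by
      refine Finset.prod_bij (fun r _ => (r : ℕ)) (fun r hr => ?_)
        (fun r _ r' _ h => Fin.ext h) (fun m hm => ?_) (fun r hr => ?_)
      · exact Finset.mem_range.2 ((residue_eq_self_iff ht).1 (Finset.mem_filter.1 hr).2)
      · have hm := Finset.mem_range.1 hm
        exact ⟨⟨m, hm.trans_le htn⟩,
          Finset.mem_filter.2 ⟨Finset.mem_univ _, (residue_eq_self_iff ht).2 hm⟩, rfl⟩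
      · have hr := (residue_eq_self_iff ht).1 (Finset.mem_filter.1 hr).2
        rw [filter_residue_eq hr, card_residueClass hn hi ⟨Nat.le_add_left 1 _, hr⟩]
        rfl
    have h2 : ∏ m ∈ Finset.range (i + (t - i)),
        (1 - (PowerSeries.X : PowerSeries ℚ) ^ (if m < i then k + 1 else k)) =
        (1 - PowerSeries.X ^ (k + 1)) ^ i * (1 - PowerSeries.X ^ k) ^ (t - i) := by
      rw [Finset.prod_range_add]
      congr 1
      · rw [Finset.prod_congr rfl fun m hm => by rw [if_pos (Finset.mem_range.1 hm)],
          Finset.prod_const, Finset.card_range]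
      · rw [Finset.prod_congr rfl fun m _ => by rw [if_neg (by omega)],
          Finset.prod_const, Finset.card_range]
    rw [h1, ← h2, Nat.add_sub_cancel' hit]
  have hspan : pascalIdeal n t K = Ideal.span (fibreProd (residue n t) K ''
      ((Finset.univ.filter fun j => residue n t j = j : Finset (Fin n)) : Set (Fin n))) := by
    rw [pascalIdeal_eq_fibreIdeal K ht htn, fibreIdeal]
    congr 2
    ext r
    simp
  rw [PowerSeries.eq_mul_inv_iff_mul_eq (by simp), hspan,
    hilbertSeries_span_fibreProd residue_residue _ fun r hr => (Finset.mem_filter.1 hr).2, hprod,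
    ← geom_sum_mul_neg, ← geom_sum_mul_neg, mul_pow, mul_pow]
  have hbot := hilbertSeries_bot (n := n) (K := K)
  rw [show n = n - t + (i + (t - i)) by omega, pow_add, pow_add,
    show n - t + (i + (t - i)) = n by omega] at hbot
  linear_combination (∑ l ∈ Finset.range (k + 1), (PowerSeries.X : PowerSeries ℚ) ^ l) ^ i *
    (∑ l ∈ Finset.range k, (PowerSeries.X : PowerSeries ℚ) ^ l) ^ (t - i) * hbot

lemma fVector_eq_iff {K : Type*} [Field K] (I J : Ideal (MvPolynomial (Fin n) K)) (d : ℕ) :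
    fVector t I d = fVector t J d ↔ (tSpreadPart I d t).ncard = (tSpreadPart J d t).ncard := by
  rw [fVector, fVector, sub_right_inj, Nat.cast_inj]

lemma fVector_pascalIdeal (K : Type*) [Field K] {k i : ℕ} (htn : t ≤ n)
    (hn : n = k * t + i) (hi : i ∈ Set.Icc 1 t) (d : ℕ) :
    fVector t (pascalIdeal n t K) d = ((n - (d - 1) * (t - 1)).choose d : ℤ) -
      ((if d = k + 1 then i else if d = k then t - i else 0 : ℕ) : ℤ) := by
  rw [fVector, ncard_tSpreadSet (hi.1.trans hi.2), ncard_tSpreadPart_pascalIdeal htn hn hi]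

lemma eq_div_mul_add {i : ℕ} (hn : t ≤ n) (hi : i ∈ Set.Icc 1 t) (h : n ≡ i [MOD t]) :
    n = (n - 1) / t * t + i := by
  obtain ⟨h1, h2⟩ := hi
  have h3 : n - 1 ≡ i - 1 [MOD t] := by
    refine Nat.ModEq.add_right_cancel' 1 ?_
    rwa [Nat.sub_add_cancel h1, Nat.sub_add_cancel (h1.trans (h2.trans hn))]
  rw [Nat.ModEq, Nat.mod_eq_of_lt (b := t) (a := i - 1) (by omega)] at h3
  have := Nat.div_add_mod' (n - 1) t
  omega

end Main

end PascalIdeal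

open PascalIdeal

theorem mainTheorem4 {K : Type*} [Field K] (n t : ℕ) (ht : 1 ≤ t) (hnt : t ≤ n) :
    -- (a)
    PascalIdeal.IsCohenMacaulayRing
      (MvPolynomial (Fin n) K ⧸ PascalIdeal.pascalIdeal n t K) ∧
    -- (b)
    (∃! p : ℕ × ℕ, PascalIdeal.IsExtremalBetti (PascalIdeal.pascalIdeal n t K) p.1 p.2) ∧
    PascalIdeal.HasProjDim (PascalIdeal.pascalIdeal n t K) (t - 1) ∧
    PascalIdeal.HasRegularity (PascalIdeal.pascalIdeal n t K) ((n : ℤ) - ((t : ℤ) - 1)) ∧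
    PascalIdeal.moduleDepth (PascalIdeal.gradedMaximalIdeal n K)
      (PascalIdeal.pascalIdeal n t K) = ((n - (t - 1) : ℕ) : ℕ∞) ∧
    ∀ i : ℕ, 1 ≤ i → i ≤ t → n ≡ i [MOD t] →
      -- (c)
      ((∀ j : ℕ, j < (n - 1) / t →
          PascalIdeal.fVector t (PascalIdeal.pascalIdeal n t K) j =
            ((n - (j - 1) * (t - 1)).choose j : ℤ)) ∧
        (∀ j : ℕ, j = (n - 1) / t →
          PascalIdeal.fVector t (PascalIdeal.pascalIdeal n t K) j =
            ((n - (j - 1) * (t - 1)).choose j : ℤ) - ((t : ℤ) - (i : ℤ))) ∧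
        (∀ j : ℕ, j = (n - 1) / t + 1 →
          PascalIdeal.fVector t (PascalIdeal.pascalIdeal n t K) j =
            ((n - (j - 1) * (t - 1)).choose j : ℤ) - (i : ℤ)) ∧
        (∀ j : ℕ, (n - 1) / t + 1 < j →
          PascalIdeal.fVector t (PascalIdeal.pascalIdeal n t K) j = 0)) ∧
      -- (d)
      PascalIdeal.hilbertSeries (PascalIdeal.pascalIdeal n t K) =
        (∑ l ∈ Finset.range ((n - 1) / t + 1), (PowerSeries.X : PowerSeries ℚ) ^ l) ^ i *
          (∑ l ∈ Finset.range ((n - 1) / t), (PowerSeries.X : PowerSeries ℚ) ^ l) ^ (t - i) *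
          ((1 - (PowerSeries.X : PowerSeries ℚ)) ^ (n - t))⁻¹ ∧
      -- (e)
      ((∃ L : Ideal (MvPolynomial (Fin n) K), PascalIdeal.IsTSpreadLexIdeal t L ∧
          ∀ j : ℕ, PascalIdeal.fVector t L j =
            PascalIdeal.fVector t (PascalIdeal.pascalIdeal n t K) j) ↔
        (i = 1 ∨ i = t - 1 ∨ i = t)) := by
  have hI := pascalIdeal_eq_fibreIdeal K ht hnt
  obtain ⟨hbound, hne⟩ := gradedBetti_fibreIdeal (K := K) residue_residue
    (card_filter_residue_eq_self ht hnt) ht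
  rw [← hI] at hbound hne
  refine ⟨?_, ⟨(t - 1, n), ⟨hne, fun p q h1 h2 h3 => ?_⟩, ?_⟩, ⟨⟨n, hne⟩, ?_⟩,
    ⟨⟨t - 1, n, hne, ?_⟩, ?_⟩, ?_, fun i hi1 hit hmod => ?_⟩
  · rw [hI]
    exact isCohenMacaulayRing_quotient_fibreIdeal residue_residue
  · by_contra hpq
    obtain ⟨h4, h5, -⟩ := hbound p q hpq
    omega
  · rintro ⟨i, j⟩ ⟨hij, hext⟩
    obtain ⟨h4, h5, h6⟩ := hbound i j hij
    simp only at hij hext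
    -- Any nonzero `β_{i,j}` with `j < n` fails to be extremal because of `β_{t-1,n}`; and `j = n`
    -- forces `i = t - 1`.
    have h7 : ¬ j + 1 ≤ n := fun h => hne (hext _ _ (by omega) (by omega) h)
    rw [Prod.mk.injEq]
    omega
  · rintro i ⟨j, hij⟩
    have := (hbound i j hij).1
    omega
  · omega
  · rintro _ ⟨i, j, hij, rfl⟩
    have := (hbound i j hij).2.1
    omega
  · have h0 : residue n t ⟨0, by omega⟩ = ⟨0, by omega⟩ :=
      (residue_eq_self_iff ht).2 (show 0 < t by omega)
    rw [hI, moduleDepth_fibreIdeal residue_residue h0, card_filter_residue_ne_self ht hnt]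
    congr 1
    omega
  · have hi : i ∈ Set.Icc 1 t := ⟨hi1, hit⟩
    have hn := eq_div_mul_add hnt hi hmod
    have hf := fVector_pascalIdeal K hnt hn hi
    refine ⟨⟨fun j hj => ?_, fun j hj => ?_, fun j hj => ?_, fun j hj => ?_⟩,
      hilbertSeries_pascalIdeal K hnt hn hi, ?_⟩
    · rw [hf, if_neg (by omega), if_neg (by omega), Nat.cast_zero, sub_zero]
    · rw [hf, if_neg (by omega), if_pos hj, Nat.cast_sub hit]
    · rw [hf, if_pos hj]
    · rw [hf, if_neg (by omega), if_neg (by omega), ← ncard_tSpreadSet ht]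
      obtain ⟨j, rfl⟩ := Nat.exists_eq_add_of_lt hj
      rw [tSpreadSet_eq_empty ht, Set.ncard_empty, Nat.cast_zero, sub_zero]
      have : ((n - 1) / t + 1) * t ≤ ((n - 1) / t + 1 + j) * t :=
        Nat.mul_le_mul_right t (Nat.le_add_right _ _)
      rw [Nat.succ_mul] at this
      omega
    · simp only [fVector_eq_iff]
      exact exists_isTSpreadLexIdeal_ncard_iff K hnt hn hi
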